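/- For graphs $G$ and $H$, let $r(G,H)$ denote the Ramsey number, i.e. the least integer $N$ such that every red-blue colouring of the edges of the complete graph $K_N$ contains a blue copy of $G$ or a red copy of $H$ (as a not necessarily induced subgraph). Let $K_3$ be the triangle, and let $Q_n$ be the $n$-dimensional hypercube, i.e. the graph with vertex set $\{0,1\}^n$ in which two vertices are adjacent if and only if they differ in exactly one coordinate. Then $$ r(K_3,Q_n) = \big(1+o(1)\big)\, 2^{n+1} \qquad \text{as } n \to \infty . $$ More precisely, $r(K_3,Q_n) \geq 2^{n+1}-1$ for every integer $n \geq 0$; and for every $\varepsilon > 0$ there exists $n_0 = n_0(\varepsilon)$ such that, for every $n \geq n_0$ and every integer $N \geq (1+\varepsilon)2^{n+1}$, every red-blue colouring of the edges of $K_N$ with no blue triangle contains a red copy of $Q_n$. -/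

import Mathlib

open Filter Asymptotics
open scoped SimpleGraph

/-- The two colours. -/
inductive EdgeColour where
  | red
  | blue

/-- A red-blue colouring of the edges of the complete graph `K_N` on `N` vertices. -/
abbrev RedBlueColouring (N : ℕ) : Type :=
  SimpleGraph.TopEdgeLabeling (Fin N) EdgeColour

/-- The graph formed by the red edges of a colouring of `K_N`. -/
abbrev redGraph {N : ℕ} (c : RedBlueColouring N) : SimpleGraph (Fin N) :=
  c.labelGraph EdgeColour.red

/-- The graph formed by the blue edges of a colouring of `K_N`. -/
abbrev blueGraph {N : ℕ} (c : RedBlueColouring N) : SimpleGraph (Fin N) :=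
  c.labelGraph EdgeColour.blue

/-- The Ramsey number `r(G, H)`: the least `N` such that every red-blue colouring of the edges
of `K_N` contains a blue copy of `G` or a red copy of `H` (copies need not be induced).
(If there were no such `N`, the value would be `0`.) -/
noncomputable def ramseyNumber {V W : Type*} (G : SimpleGraph V) (H : SimpleGraph W) : ℕ :=
  sInf {N : ℕ | ∀ c : RedBlueColouring N, G ⊑ blueGraph c ∨ H ⊑ redGraph c}

/-- The triangle `K_3`. -/
abbrev triangleGraph : SimpleGraph (Fin 3) := ⊤

/-- The `n`-dimensional hypercube `Q_n`: the vertex set is `{0,1}^n`, and two vertices are adjacent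
if and only if they differ in exactly one coordinate. -/
def hypercubeGraph (n : ℕ) : SimpleGraph (Fin n → Bool) where
  Adj x y := hammingDist x y = 1
  symm := ⟨fun x y h => by rw [hammingDist_comm]; exact h⟩
  loopless := ⟨fun x h => by simp at h⟩

/-! Upper bound. Let `G` be the blue graph: it is triangle-free on slightly more than `2 ^ (n + 1)`
vertices, and the cube has to be placed in its complement. Neighbourhoods in `G` are edgeless, and
any part of the cube can be placed freely inside an edgeless set. Peeling off subsets of
neighbourhoods of size `2 ^ (n - K)` (`exists_edgeless_family`) leaves a remainder into which every
vertex has fewer than `2 ^ (n - K)` neighbours. As `K` grows along a suitable sequence, the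
remainder can shrink by a fixed proportion of `2 ^ n` only boundedly often. At a scale where it
hardly shrinks there are boundedly many large edgeless sets and a remainder `R` whose degrees are
far below the sizes of these sets. Two cases follow.

If `R` is not negligible (`exists_embedding_of_card_sparse_ge`), a total slightly above `2 ^ n`
suffices. Weight in the first `K` coordinates cuts the cube into intervals, one for each large set;
dropping one layer between consecutive intervals removes all edges between them. What is left goes
into `R`. It is cut into subcubes of increasing codimension `k`, and each gets an edgeless block of
`R` slightly larger than itself. Low degrees mean that few blocks are densely joined to a given one,
and a subcube of codimension `k` meets at most `k` subcubes at least as large as itself. A greedy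
choice of blocks, largest subcubes first, therefore wastes about `k ^ 3` blocks at level `k`, a
negligible share because the tail of `∑ k ^ 3 / 2 ^ k` is small.

If `R` is negligible (`exists_embedding_of_card_edgeless_ge`), the large sets hold more than `2 * 2
^ n` vertices. Three of them cannot be pairwise almost completely joined (`not_three_dense`), so the
relation "not almost completely joined" has at most two components, one of which holds more than `2
^ n` vertices. A bounded walk visits that component. The cube follows it by weight, crossing from
one set to the next inside small complete bipartite patterns of non-edges, one for each fibre over
the remaining coordinates. Only this case needs the factor `2`.

Lower bound (`le_ramseyNumber`): two red cliques on at most `2 ^ n - 1` vertices each, joined in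
blue. -/

/-! ### Greedy choice -/

open Finset in
/-- Greedy choice: if every `x` can always be given a value compatible with any choice of values
for points of smaller or equal rank, then pairwise compatible values exist. -/
theorem exists_greedy_choice {X V : Type*} [DecidableEq X] [Nonempty V] (s : Finset X) (r : X → ℕ)
    (A : X → Set V) (bad : X → X → V → V → Prop)
    (hsymm : ∀ x y v w, bad x y v w → bad y x w v)
    (h : ∀ x ∈ s, ∀ t ⊆ s, x ∉ t → (∀ y ∈ t, r y ≤ r x) → ∀ f : X → V, (∀ y ∈ t, f y ∈ A y) →
      ∃ v ∈ A x, ∀ y ∈ t, ¬ bad x y v (f y)) :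
    ∃ f : X → V, (∀ x ∈ s, f x ∈ A x) ∧ ∀ x ∈ s, ∀ y ∈ s, x ≠ y → ¬ bad x y (f x) (f y) := by
  suffices H : ∀ t : Finset X, t ⊆ s → ∃ f : X → V, (∀ x ∈ t, f x ∈ A x) ∧
      ∀ x ∈ t, ∀ y ∈ t, x ≠ y → ¬ bad x y (f x) (f y) from H s subset_rfl
  intro t
  induction t using Finset.induction_on_max_value r with
  | empty => exact fun _ => ⟨fun _ => Classical.arbitrary V, by simp, by simp⟩
  | insert a t hat hmax ih =>
    intro hts
    obtain ⟨f, hf, hfb⟩ := ih ((subset_insert _ _).trans hts)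
    obtain ⟨v, hv, hvb⟩ := h a (hts (mem_insert_self _ _)) t ((subset_insert _ _).trans hts) hat
      hmax f hf
    have hne : ∀ y ∈ t, y ≠ a := fun y hy e => hat (e ▸ hy)
    refine ⟨Function.update f a v, ?_, ?_⟩
    · intro x hx
      rcases mem_insert.1 hx with rfl | hx
      · simpa using hv
      · simpa [hne x hx] using hf x hx
    · intro x hx y hy hxy
      rcases mem_insert.1 hx with rfl | hx' <;> rcases mem_insert.1 hy with rfl | hy'
      · exact absurd rfl hxy
      · simpa [hne y hy'] using hvb y hy'
      · intro hb
        apply hvb x hx'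
        simpa [hne x hx'] using hsymm _ _ _ _ hb
      · simpa [hne x hx', hne y hy'] using hfb x hx' y hy' hxy

/-! ### Degrees and edgeless sets in triangle-free graphs -/

open Classical in
/-- The number of neighbours of `u` in `T`. -/
noncomputable def degreeInto {V : Type*} (G : SimpleGraph V) (u : V) (T : Finset V) : ℕ :=
  (T.filter (G.Adj u)).card

theorem degreeInto_mono {V : Type*} (G : SimpleGraph V) (u : V) {S T : Finset V} (h : S ⊆ T) :
    degreeInto G u S ≤ degreeInto G u T := by
  classical
  exact Finset.card_le_card (Finset.filter_subset_filter _ h)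

open Finset in
theorem sum_degreeInto_comm {V : Type*} (G : SimpleGraph V) (S T : Finset V) :
    ∑ u ∈ S, degreeInto G u T = ∑ u ∈ T, degreeInto G u S := by
  classical
  have h := Finset.sum_card_bipartiteAbove_eq_sum_card_bipartiteBelow (s := S) (t := T) G.Adj
  unfold bipartiteAbove bipartiteBelow at h
  unfold degreeInto
  simp only [G.adj_comm] at h ⊢
  convert h using 4

/-- A set of vertices without edges. -/
def IsEdgeless {V : Type*} (G : SimpleGraph V) (S : Finset V) : Prop :=
  ∀ u ∈ S, ∀ v ∈ S, ¬ G.Adj u v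

theorem IsEdgeless.subset {V : Type*} {G : SimpleGraph V} {S T : Finset V} (h : IsEdgeless G T)
    (hST : S ⊆ T) : IsEdgeless G S := fun u hu v hv => h u (hST hu) v (hST hv)

theorem IsEdgeless.degreeInto_eq_zero {V : Type*} {G : SimpleGraph V} {S : Finset V}
    (h : IsEdgeless G S) {u : V} (hu : u ∈ S) {T : Finset V} (hT : T ⊆ S) :
    degreeInto G u T = 0 := by
  classical
  unfold degreeInto
  simp only [Finset.card_eq_zero, Finset.filter_eq_empty_iff]
  exact fun v hv => h u hu v (hT hv)

open Finset in
/-- In a triangle-free graph one can remove disjoint edgeless `s`-sets from `R` until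
every vertex has fewer than `s` neighbours in what remains. -/
theorem exists_edgeless_family {V : Type*} [DecidableEq V] (G : SimpleGraph V)
    (hG : ∀ a b c, G.Adj a b → G.Adj a c → ¬ G.Adj b c) {s : ℕ} (hs : 0 < s) (R : Finset V) :
    ∃ F : Finset (Finset V), (∀ S ∈ F, S ⊆ R ∧ S.card = s ∧ IsEdgeless G S) ∧
      (∀ S ∈ F, ∀ T ∈ F, S ≠ T → Disjoint S T) ∧
      ∀ v, degreeInto G v (R \ F.biUnion id) < s := by
  classical
  induction hm : R.card using Nat.strong_induction_on generalizing R with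
  | _ m ih =>
    by_cases hv : ∃ v, s ≤ degreeInto G v R
    · obtain ⟨v, hv⟩ := hv
      obtain ⟨S, hSR, hS⟩ := exists_subset_card_eq hv
      have hSR' : S ⊆ R := hSR.trans (filter_subset _ _)
      -- All of `S` lies in the neighbourhood of `v`, so an edge inside `S` would close a triangle.
      have hSind : IsEdgeless G S := fun a ha b hb =>
        hG v a b (mem_filter.1 (hSR ha)).2 (mem_filter.1 (hSR hb)).2
      have hlt : (R \ S).card < m := by
        rw [card_sdiff_of_subset hSR', hS, hm]
        have := card_le_card hSR'
        omega
      obtain ⟨F, h1, h2, h3⟩ := ih _ hlt (R \ S) rfl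
      have hd : ∀ T ∈ F, Disjoint S T := fun T hT =>
        disjoint_sdiff.mono_right (h1 T hT).1
      refine ⟨insert S F, ?_, ?_, ?_⟩
      · intro T hT
        rcases mem_insert.1 hT with rfl | hT
        · exact ⟨hSR', hS, hSind⟩
        · exact ⟨(h1 T hT).1.trans sdiff_subset, (h1 T hT).2⟩
      · intro T hT T' hT' hne
        rcases mem_insert.1 hT with e | hT <;> rcases mem_insert.1 hT' with e' | hT'
        · exact absurd (e.trans e'.symm) hne
        · exact e ▸ hd _ hT'
        · exact e' ▸ (hd _ hT).symm
        · exact h2 _ hT _ hT' hne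
      · intro u
        have : R \ (insert S F).biUnion id = (R \ S) \ F.biUnion id := by
          rw [biUnion_insert, sdiff_sdiff_left]; rfl
        rw [this]
        exact h3 u
    · push Not at hv
      exact ⟨∅, by simp, by simp, by simpa using hv⟩

/-! ### Embedding into mutually sparse blocks -/

open Finset in
/-- If a graph is partitioned into parts so that few edges at each vertex leave its part, and
each part is allotted an edgeless block of `G` slightly larger than itself so that `G` is
sparse between blocks of adjacent parts, then the graph embeds into the complement of `G`. -/
theorem exists_embedding_of_sparse_blocks {X V P : Type*} [Fintype X] [DecidableEq X]
    [DecidableEq P] [DecidableEq V] [Nonempty V]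
    (H : SimpleGraph X) [DecidableRel H.Adj] (G : SimpleGraph V) (p : X → P) (S : P → Finset V)
    (κ : P → ℕ) {q : ℕ}
    (hκ : ∀ x, 0 < κ (p x))
    (hind : ∀ x, IsEdgeless G (S (p x)))
    (hdisj : ∀ x y, p x ≠ p y → Disjoint (S (p x)) (S (p y)))
    (hout : ∀ x, (univ.filter fun y => H.Adj x y ∧ p y ≠ p x).card ≤ κ (p x))
    (hsparse : ∀ x y, H.Adj x y → p x ≠ p y →
      4 * q ^ 2 * κ (p x) * κ (p y) * ∑ u ∈ S (p x), degreeInto G u (S (p y))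
        ≤ (S (p x)).card * (S (p y)).card)
    (hsize : ∀ x, (univ.filter fun y => p y = p x).card * q + (S (p x)).card
      < ((S (p x)).card + 1) * q) :
    ∃ f : X → V, Function.Injective f ∧ ∀ x y, H.Adj x y → ¬ G.Adj (f x) (f y) := by
  classical
  let out : X → Finset X := fun x => univ.filter fun y => H.Adj x y ∧ p y ≠ p x
  -- The typical vertices for `x`: their degree into the block of each outside neighbour `y` is at
  -- most a `1 / (2 q κ)` fraction of it, so that placing `x` spoils little of the room for `y`.
  let A : X → Finset V := fun x => (S (p x)).filter fun u =>
    ∀ y ∈ out x, 2 * q * κ (p y) * degreeInto G u (S (p y)) ≤ (S (p y)).card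
  obtain ⟨f, hfA, hf⟩ := exists_greedy_choice (univ : Finset X) (fun _ => 0) (fun x => ↑(A x))
    (fun x y v w => v = w ∨ (H.Adj x y ∧ G.Adj v w))
    (by
      rintro x y v w (h | ⟨h, h'⟩)
      · exact Or.inl h.symm
      · exact Or.inr ⟨h.symm, h'.symm⟩)
    (by
      intro x _ t _ hxt _ f hf
      have hf' : ∀ y ∈ t, f y ∈ S (p y) := fun y hy => (mem_filter.1 (hf y hy)).1
      -- Forbidden for `x`: atypical vertices (`B1`), `G`-neighbours of placed outside neighbours
      -- (`B2`), and images already used by the same part (`B3`). Over all outside neighbours, `B1`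
      -- and `B2` each cost at most `1 / (2 q)` of the block, and `hsize` leaves room for both and
      -- `B3`.
      let B1 : X → Finset V := fun y => (S (p x)).filter fun u =>
        (S (p y)).card < 2 * q * κ (p y) * degreeInto G u (S (p y))
      let B2 : X → Finset V := fun y => if y ∈ t then (S (p x)).filter (G.Adj (f y)) else ∅
      let B3 : Finset V := ((univ.filter fun y => p y = p x).erase x).image f
      have h1 : ∀ y ∈ out x, (B1 y).card * (2 * q * κ (p x)) ≤ (S (p x)).card := by
        intro y hy
        obtain ⟨hadj, hne⟩ := (mem_filter.1 hy).2
        have hs := hsparse x y hadj hne.symm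
        rcases Nat.eq_zero_or_pos (S (p y)).card with h0 | hpos
        · have : S (p y) = ∅ := card_eq_zero.1 h0
          have : (B1 y) = ∅ := by
            simp [B1, this, degreeInto]
          simp [this]
        · have hsum : (B1 y).card * (S (p y)).card ≤
              2 * q * κ (p y) * ∑ u ∈ S (p x), degreeInto G u (S (p y)) := by
            calc (B1 y).card * (S (p y)).card = ∑ u ∈ B1 y, (S (p y)).card := by simp
              _ ≤ ∑ u ∈ B1 y, 2 * q * κ (p y) * degreeInto G u (S (p y)) :=
                  sum_le_sum fun u hu => (mem_filter.1 hu).2.le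
              _ ≤ ∑ u ∈ S (p x), 2 * q * κ (p y) * degreeInto G u (S (p y)) :=
                  sum_le_sum_of_subset (filter_subset _ _)
              _ = _ := by rw [mul_sum]
          refine Nat.le_of_mul_le_mul_right ?_ hpos
          calc (B1 y).card * (2 * q * κ (p x)) * (S (p y)).card
              = (2 * q * κ (p x)) * ((B1 y).card * (S (p y)).card) := by ring
            _ ≤ (2 * q * κ (p x)) * (2 * q * κ (p y) *
                  ∑ u ∈ S (p x), degreeInto G u (S (p y))) := Nat.mul_le_mul_left _ hsum
            _ = 4 * q ^ 2 * κ (p x) * κ (p y) * ∑ u ∈ S (p x), degreeInto G u (S (p y)) := by ring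
            _ ≤ _ := hs
      have h2 : ∀ y ∈ out x, (B2 y).card * (2 * q * κ (p x)) ≤ (S (p x)).card := by
        intro y hy
        obtain ⟨hadj, hne⟩ := (mem_filter.1 hy).2
        by_cases hyt : y ∈ t
        · have := (mem_filter.1 (hf y hyt)).2 x (mem_filter.2 ⟨mem_univ _, hadj.symm, hne.symm⟩)
          simp only [B2, if_pos hyt]
          rw [mul_comm]
          exact this
        · simp [B2, hyt]
      have key : ∀ B : X → Finset V,
          (∀ y ∈ out x, (B y).card * (2 * q * κ (p x)) ≤ (S (p x)).card) →
          ((out x).biUnion B).card * (2 * q) ≤ (S (p x)).card := by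
        intro B hB
        refine Nat.le_of_mul_le_mul_right ?_ (hκ x)
        calc ((out x).biUnion B).card * (2 * q) * κ (p x)
            ≤ (∑ y ∈ out x, (B y).card) * (2 * q) * κ (p x) := by
              gcongr; exact card_biUnion_le
          _ = ∑ y ∈ out x, (B y).card * (2 * q * κ (p x)) := by
              rw [sum_mul, sum_mul]; exact sum_congr rfl fun _ _ => by ring
          _ ≤ ∑ y ∈ out x, (S (p x)).card := sum_le_sum hB
          _ = (out x).card * (S (p x)).card := by simp
          _ ≤ κ (p x) * (S (p x)).card := Nat.mul_le_mul_right _ (hout x)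
          _ = _ := mul_comm _ _
      have k1 := key B1 h1
      have k2 := key B2 h2
      have k3 : B3.card + 1 ≤ (univ.filter fun y => p y = p x).card := by
        have hx : x ∈ univ.filter fun y => p y = p x := by simp
        have h4 : B3.card ≤ _ := card_image_le
        have := card_erase_add_one hx
        omega
      have hcard : ((out x).biUnion B1 ∪ (out x).biUnion B2 ∪ B3).card < (S (p x)).card := by
        have hu1 := card_union_le ((out x).biUnion B1 ∪ (out x).biUnion B2) B3
        have hu2 := card_union_le ((out x).biUnion B1) ((out x).biUnion B2)
        have hs := hsize x
        refine Nat.lt_of_mul_lt_mul_right (a := q) ?_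
        have k3' := Nat.mul_le_mul_right q k3
        have := Nat.mul_le_mul_right q (hu1.trans (Nat.add_le_add_right hu2 _))
        nlinarith
      obtain ⟨v, hvS, hvB⟩ := exists_mem_notMem_of_card_lt_card hcard
      simp only [mem_union, mem_biUnion, not_or, not_exists, not_and] at hvB
      obtain ⟨⟨hv1, hv2⟩, hv3⟩ := hvB
      refine ⟨v, ?_, ?_⟩
      · refine mem_coe.2 (mem_filter.2 ⟨hvS, fun y hy => ?_⟩)
        by_contra hlt
        exact hv1 y hy (mem_filter.2 ⟨hvS, not_le.1 hlt⟩)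
      · rintro y hyt (h | ⟨h, h'⟩)
        · by_cases hp : p y = p x
          · apply hv3
            refine mem_image.2 ⟨y, mem_erase.2 ⟨fun e => hxt (e ▸ hyt), ?_⟩, h.symm⟩
            simpa using hp
          · exact (disjoint_left.1 (hdisj y x hp) (hf' y hyt)) (h ▸ hvS)
        · by_cases hp : p y = p x
          · exact hind x v hvS (f y) (hp ▸ hf' y hyt) h'
          · refine hv2 y (mem_filter.2 ⟨mem_univ _, h, hp⟩) ?_
            simp only [B2, if_pos hyt]
            exact mem_filter.2 ⟨hvS, h'.symm⟩)
  refine ⟨f, fun x y hxy => ?_, fun x y hxy hadj => ?_⟩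
  · by_contra hne
    exact hf x (mem_univ _) y (mem_univ _) hne (Or.inl hxy)
  · exact hf x (mem_univ _) y (mem_univ _) hxy.ne (Or.inr ⟨hxy, hadj⟩)

/-! ### Subcubes of the hypercube -/

/-- Change the `i`-th coordinate of a vertex of the cube. -/
def flipBit {n : ℕ} (i : Fin n) (x : Fin n → Bool) : Fin n → Bool :=
  Function.update x i (!x i)

theorem hypercubeGraph_adj_iff {n : ℕ} {x y : Fin n → Bool} :
    (hypercubeGraph n).Adj x y ↔ ∃ i, y = flipBit i x := by
  change hammingDist x y = 1 ↔ _
  rw [hammingDist, Finset.card_eq_one]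
  refine exists_congr fun i => ?_
  rw [Finset.ext_iff]
  constructor
  · intro h
    funext j
    have hj := h j
    simp only [Finset.mem_filter, Finset.mem_univ, true_and, Finset.mem_singleton] at hj
    by_cases hji : j = i
    · subst hji
      have : x j ≠ y j := hj.2 rfl
      simp only [flipBit, Function.update_self]
      revert this
      cases x j <;> cases y j <;> simp
    · have : x j = y j := by
        by_contra hne
        exact hji (hj.1 hne)
      simp [flipBit, hji, this]
  · rintro rfl j
    simp only [Finset.mem_filter, Finset.mem_univ, true_and, Finset.mem_singleton]
    by_cases hji : j = i
    · subst hji; simp [flipBit]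
    · simp [flipBit, hji]

instance (n : ℕ) : DecidableRel (hypercubeGraph n).Adj :=
  fun x y => inferInstanceAs (Decidable (hammingDist x y = 1))

/-- Keep the first `k` coordinates and set the others to `false`. -/
def cubePrefix {n : ℕ} (k : ℕ) (x : Fin n → Bool) : Fin n → Bool :=
  fun i => if i.1 < k then x i else false

theorem cubePrefix_eq_iff {n : ℕ} {k : ℕ} {x y : Fin n → Bool} :
    cubePrefix k x = cubePrefix k y ↔ ∀ i : Fin n, i.1 < k → x i = y i := by
  refine ⟨fun h i hi => ?_, fun h => ?_⟩
  · have := congrFun h i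
    simpa [cubePrefix, hi] using this
  · funext i
    by_cases hi : i.1 < k
    · simpa [cubePrefix, hi] using h i hi
    · simp [cubePrefix, hi]

theorem cubePrefix_cubePrefix {n : ℕ} (k : ℕ) (x : Fin n → Bool) :
    cubePrefix k (cubePrefix k x) = cubePrefix k x :=
  cubePrefix_eq_iff.2 fun i hi => by simp [cubePrefix, hi]

theorem cubePrefix_eq_mono {n : ℕ} {k l : ℕ} (hkl : k ≤ l) {x y : Fin n → Bool}
    (h : cubePrefix l x = cubePrefix l y) : cubePrefix k x = cubePrefix k y :=
  cubePrefix_eq_iff.2 fun i hi => cubePrefix_eq_iff.1 h i (hi.trans_le hkl)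

theorem cubePrefix_flipBit_of_le {n : ℕ} {k : ℕ} {i : Fin n} (h : k ≤ i.1) (x : Fin n → Bool) :
    cubePrefix k (flipBit i x) = cubePrefix k x :=
  cubePrefix_eq_iff.2 fun j hj => by
    have : j ≠ i := fun e => by subst e; omega
    simp [flipBit, this]

theorem cubePrefix_flipBit_congr {n : ℕ} {k : ℕ} {i : Fin n} {x y : Fin n → Bool}
    (h : cubePrefix k x = cubePrefix k y) :
    cubePrefix k (flipBit i x) = cubePrefix k (flipBit i y) :=
  cubePrefix_eq_iff.2 fun j hj => by
    have := cubePrefix_eq_iff.1 h j hj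
    by_cases hji : j = i
    · subst hji; simp [flipBit, this]
    · simp [flipBit, hji, this]

open Finset in
theorem card_cubePrefix_class {n k : ℕ} (hk : k ≤ n) (x : Fin n → Bool) :
    (univ.filter fun y : Fin n → Bool => cubePrefix k y = cubePrefix k x).card = 2 ^ (n - k) := by
  have : (univ.filter fun y : Fin n → Bool => cubePrefix k y = cubePrefix k x) =
      Fintype.piFinset fun i : Fin n => if i.1 < k then {x i} else univ := by
    ext y
    simp only [mem_filter, mem_univ, true_and, cubePrefix_eq_iff, Fintype.mem_piFinset]
    refine forall_congr' fun i => ?_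
    by_cases hi : i.1 < k <;> simp [hi]
  rw [this, Fintype.card_piFinset]
  have h2 : ∀ i : Fin n, (if i.1 < k then ({x i} : Finset Bool) else univ).card =
      if i.1 < k then 1 else 2 := by
    intro i; split_ifs <;> simp
  rw [prod_congr rfl fun i _ => h2 i, prod_ite]
  simp only [prod_const_one, one_mul, prod_const]
  congr 1
  have h3 := card_filter_add_card_filter_not (s := (univ : Finset (Fin n))) (fun i => i.1 < k)
  have h4 : (univ.filter fun i : Fin n => i.1 < k).card = k := by
    rw [Fin.card_filter_val_lt]; omega
  simp only [card_univ, Fintype.card_fin] at h3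
  omega

/-- A set of vertices of the cube that is a union of classes of the first `k` coordinates. -/
def PrefixClosed {n : ℕ} (k : ℕ) (U : Finset (Fin n → Bool)) : Prop :=
  ∀ x y, cubePrefix k x = cubePrefix k y → x ∈ U → y ∈ U

theorem PrefixClosed.mono {n k l : ℕ} (hkl : k ≤ l) {U : Finset (Fin n → Bool)}
    (h : PrefixClosed k U) : PrefixClosed l U :=
  fun x y hxy => h x y (cubePrefix_eq_mono hkl hxy)

open Finset in
theorem PrefixClosed.card {n k : ℕ} (hk : k ≤ n) {U : Finset (Fin n → Bool)}
    (h : PrefixClosed k U) : U.card = (U.image (cubePrefix k)).card * 2 ^ (n - k) := by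
  rw [card_eq_sum_card_image (cubePrefix k) U, sum_const_nat]
  intro z hz
  obtain ⟨x, hx, rfl⟩ := mem_image.1 hz
  rw [← card_cubePrefix_class hk x]
  congr 1
  ext y
  simp only [mem_filter, mem_univ, true_and, and_iff_right_iff_imp]
  exact fun e => h x y e.symm hx

open Finset in
/-- A region of the cube can be cut into subcubes with prescribed numbers of subcubes of each
codimension, if these have enough vertices in total. -/
theorem exists_level_function {n : ℕ} (u : ℕ → ℕ) (K : ℕ) (hK : K ≤ n)
    (U : Finset (Fin n → Bool)) (hU : PrefixClosed K U)
    (h : U.card ≤ ∑ k ∈ Ioc K n, u k * 2 ^ (n - k)) :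
    ∃ lev : (Fin n → Bool) → ℕ, (∀ x ∈ U, lev x ∈ Ioc K n) ∧
      ∀ k ∈ Ioc K n, PrefixClosed k (U.filter fun x => lev x = k) ∧
        ((U.filter fun x => lev x = k).image (cubePrefix k)).card ≤ u k := by
  induction hd : n - K generalizing K U with
  | zero =>
    have : Ioc K n = ∅ := Ioc_eq_empty (by omega)
    rw [this] at h ⊢
    have hU0 : U = ∅ := by simpa using h
    exact ⟨fun _ => 0, by simp [hU0], by simp⟩
  | succ d ih =>
    have hKn : K + 1 ≤ n := by omega
    have hU' := hU.mono (Nat.le_succ K)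
    -- Largest subcubes first: take `u (K + 1)` of codimension `K + 1`, or all that exist, in which
    -- case nothing remains to be cut.
    obtain ⟨I, hIU, hI⟩ := exists_subset_card_eq
      (min_le_right (u (K + 1)) (U.image (cubePrefix (K + 1))).card)
    let T := U.filter fun x => cubePrefix (K + 1) x ∈ I
    have hT : PrefixClosed (K + 1) T := by
      intro x y hxy hx
      obtain ⟨h1, h2⟩ := mem_filter.1 hx
      exact mem_filter.2 ⟨hU' x y hxy h1, hxy ▸ h2⟩
    have hTI : T.image (cubePrefix (K + 1)) = I := by
      ext z
      constructor
      · intro hz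
        obtain ⟨x, hx, rfl⟩ := mem_image.1 hz
        exact (mem_filter.1 hx).2
      · intro hz
        obtain ⟨x, hx, rfl⟩ := mem_image.1 (hIU hz)
        exact mem_image_of_mem _ (mem_filter.2 ⟨hx, hz⟩)
    have hUT : PrefixClosed (K + 1) (U \ T) := by
      intro x y hxy hx
      obtain ⟨h1, h2⟩ := Finset.mem_sdiff.1 hx
      exact Finset.mem_sdiff.2 ⟨hU' x y hxy h1, fun h => h2 (hT y x hxy.symm h)⟩
    have hsplit : ∑ k ∈ Ioc K n, u k * 2 ^ (n - k) =
        u (K + 1) * 2 ^ (n - (K + 1)) + ∑ k ∈ Ioc (K + 1) n, u k * 2 ^ (n - k) := by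
      rw [← Finset.insert_Ioc_add_one_left_eq_Ioc (by omega : K < n), sum_insert (by simp)]
    have hcard : (U \ T).card ≤ ∑ k ∈ Ioc (K + 1) n, u k * 2 ^ (n - k) := by
      have hTU : T ⊆ U := filter_subset _ _
      rw [card_sdiff_of_subset hTU]
      have h1 := hT.card hKn
      have h2 := hU'.card hKn
      rw [hTI, hI] at h1
      rcases le_total (u (K + 1)) (U.image (cubePrefix (K + 1))).card with hle | hle
      · rw [min_eq_left hle] at h1
        omega
      · rw [min_eq_right hle] at h1
        omega
    obtain ⟨lev, hl1, hl2⟩ := ih (K + 1) hKn (U \ T) hUT hcard (by omega)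
    have hfilt : ∀ k ∈ Ioc (K + 1) n,
        (U.filter fun x => (if x ∈ T then K + 1 else lev x) = k) =
          (U \ T).filter fun x => lev x = k := by
      intro k hk
      have := (mem_Ioc.1 hk).1
      ext x
      simp only [mem_filter, Finset.mem_sdiff]
      by_cases hx : x ∈ T
      · simp only [hx, if_true, not_true, and_false, false_and, iff_false, not_and]
        omega
      · simp [hx]
    have hfilt' : (U.filter fun x => (if x ∈ T then K + 1 else lev x) = K + 1) = T := by
      ext x
      simp only [mem_filter]
      by_cases hx : x ∈ T
      · simp [hx, (mem_filter.1 hx).1]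
      · simp only [hx, if_false, iff_false, not_and]
        intro hxU
        have := (mem_Ioc.1 (hl1 x (Finset.mem_sdiff.2 ⟨hxU, hx⟩))).1
        omega
    refine ⟨fun x => if x ∈ T then K + 1 else lev x, ?_, ?_⟩
    · intro x hx
      by_cases hxT : x ∈ T
      · simp [hxT]; omega
      · have := mem_Ioc.1 (hl1 x (Finset.mem_sdiff.2 ⟨hx, hxT⟩))
        simp [hxT]; omega
    · intro k hk
      rw [← Finset.insert_Ioc_add_one_left_eq_Ioc (by omega : K < n), mem_insert] at hk
      rcases hk with rfl | hk
      · rw [hfilt', hTI, hI]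
        exact ⟨hT, min_le_left _ _⟩
      · rw [hfilt k hk]
        exact hl2 k hk

/-! ### Assigning blocks to subcubes -/

open Finset in
/-- A decomposition of the cube into subcubes of varying codimension `lev`, together with supplies
of edgeless blocks for the subcubes of each kind, yields an embedding of the cube into
the complement of `G` provided that few blocks of a supply are densely joined to a given block. -/
theorem exists_embedding_of_levels {V γ : Type*} [DecidableEq V] [Nonempty V] [DecidableEq γ]
    {n : ℕ} (G : SimpleGraph V) {q : ℕ} (lev : (Fin n → Bool) → ℕ)
    (hlev : ∀ x, 0 < lev x ∧ lev x ≤ n)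
    (hclosed : ∀ x y, cubePrefix (lev x) x = cubePrefix (lev x) y → lev y = lev x)
    (col : (Fin n → Bool) → γ)
    (hcol : ∀ x y, cubePrefix (lev x) x = cubePrefix (lev x) y → col y = col x)
    (Fam : γ → Finset (Finset V))
    (hdisj : ∀ g g' S T, S ∈ Fam g → T ∈ Fam g' → (g ≠ g' ∨ S ≠ T) → Disjoint S T)
    (hne : ∀ g, ∀ S ∈ Fam g, S.Nonempty)
    (hind : ∀ g, ∀ S ∈ Fam g, IsEdgeless G S)
    (hsize : ∀ x, ∀ S ∈ Fam (col x), 2 ^ (n - lev x) * q + S.card < (S.card + 1) * q)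
    (B : γ → ℕ)
    (hB : ∀ x y, (hypercubeGraph n).Adj x y → lev y ≤ lev x → ∀ T ∈ Fam (col y),
      ((Fam (col x)).filter fun S => S.card * T.card <
        4 * q ^ 2 * lev x * lev y * ∑ u ∈ S, degreeInto G u T).card ≤ B (col x))
    (hcount : ∀ x, ((univ.filter fun y => col y = col x).image
      fun y => cubePrefix (lev y) y).card + lev x * B (col x) ≤ (Fam (col x)).card) :
    ∃ f : (Fin n → Bool) → V, Function.Injective f ∧
      ∀ x y, (hypercubeGraph n).Adj x y → ¬ G.Adj (f x) (f y) := by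
  classical
  let rep : (Fin n → Bool) → (Fin n → Bool) := fun y => cubePrefix (lev y) y
  have hpre : ∀ x, cubePrefix (lev x) x = cubePrefix (lev x) (rep x) :=
    fun x => (cubePrefix_cubePrefix _ _).symm
  have hlevrep : ∀ x, lev (rep x) = lev x := fun x => hclosed _ _ (hpre x)
  have hcolrep : ∀ x, col (rep x) = col x := fun x => hcol _ _ (hpre x)
  have hreprep : ∀ x, rep (rep x) = rep x := fun x => by
    change cubePrefix (lev (rep x)) (rep x) = _
    rw [hlevrep, ← hpre x]
  have hrep_eq : ∀ x y, cubePrefix (lev x) x = cubePrefix (lev x) y → rep y = rep x := by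
    intro x y h
    change cubePrefix (lev y) y = cubePrefix (lev x) x
    rw [hclosed x y h, h]
  have hout : ∀ x (i : Fin n), rep (flipBit i x) ≠ rep x → i.1 < lev x := by
    intro x i h
    by_contra hi
    exact h (hrep_eq x _ (cubePrefix_flipBit_of_le (not_lt.1 hi) x).symm)
  -- A neighbouring subcube of no larger codimension is determined by the flipped coordinate alone,
  -- so there are at most `lev x` of them. Smaller neighbouring subcubes may be far more numerous.
  have hlow : ∀ x (i : Fin n), lev (flipBit i x) ≤ lev x →
      rep (flipBit i x) = rep (flipBit i (rep x)) := by
    intro x i h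
    refine (hrep_eq (flipBit i x) (flipBit i (rep x)) ?_).symm
    exact cubePrefix_eq_mono h (cubePrefix_flipBit_congr (hpre x))
  let dense : (Fin n → Bool) → (Fin n → Bool) → Finset V → Finset V → Prop := fun c c' S T =>
    S.card * T.card < 4 * q ^ 2 * lev c * lev c' * ∑ u ∈ S, degreeInto G u T
  have dense_symm : ∀ c c' S T, dense c c' S T → dense c' c T S := by
    intro c c' S T h
    change T.card * S.card < 4 * q ^ 2 * lev c' * lev c * ∑ u ∈ T, degreeInto G u S
    rw [sum_degreeInto_comm, mul_comm T.card, mul_right_comm (4 * q ^ 2)]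
    exact h
  let adjP : (Fin n → Bool) → (Fin n → Bool) → Prop := fun c c' =>
    ∃ x y, (hypercubeGraph n).Adj x y ∧ rep x = c ∧ rep y = c'
  -- Rank is codimension, so when a subcube is treated its neighbours already served are no smaller.
  -- At most `lev` of them each exclude at most `B` blocks, which is what `hcount` pays for.
  obtain ⟨σ, hσA, hσ⟩ := exists_greedy_choice (univ.image rep) lev (fun c => ↑(Fam (col c)))
    (fun c c' S T => S = T ∨ (adjP c c' ∧ dense c c' S T))
    (by
      rintro c c' S T (h | ⟨⟨x, y, h1, h2, h3⟩, h⟩)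
      · exact Or.inl h.symm
      · exact Or.inr ⟨⟨y, x, h1.symm, h3, h2⟩, dense_symm _ _ _ _ h⟩)
    (by
      intro c hc t hts hct hr f hf
      obtain ⟨x₀, -, rfl⟩ := mem_image.1 hc
      have htrep : ∀ c' ∈ t, rep c' = c' := by
        intro c' hc'
        obtain ⟨y, -, rfl⟩ := mem_image.1 (hts hc')
        exact hreprep y
      set c := rep x₀ with hcdef
      have hcrep : rep c = c := hreprep x₀
      let I : Finset (Fin n) := univ.filter fun i => i.1 < lev c ∧
        rep (flipBit i c) ∈ t ∧ adjP c (rep (flipBit i c))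
      let E1 : Finset (Finset V) := (t.filter fun c' => col c' = col c).image f
      let E2 : Fin n → Finset (Finset V) := fun i => (Fam (col c)).filter fun S =>
        dense c (rep (flipBit i c)) S (f (rep (flipBit i c)))
      have hE1 : E1.card + 1 ≤ ((univ.filter fun y => col y = col c).image rep).card := by
        have hcm : c ∈ (univ.filter fun y => col y = col c).image rep :=
          mem_image.2 ⟨c, by simp, hcrep⟩
        have hsub : (t.filter fun c' => col c' = col c) ⊆
            ((univ.filter fun y => col y = col c).image rep).erase c := by
          intro c' hc'
          obtain ⟨h1, h2⟩ := mem_filter.1 hc'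
          refine mem_erase.2 ⟨fun e => hct (e ▸ h1), mem_image.2 ⟨c', by simpa using h2, htrep _ h1⟩⟩
        have h1 := card_le_card hsub
        have h2 := card_erase_add_one hcm
        have h3 : E1.card ≤ _ := card_image_le
        omega
      have hE2 : ∀ i ∈ I, (E2 i).card ≤ B (col c) := by
        intro i hi
        obtain ⟨-, -, hit, x, y, hxy, hx, hy⟩ := mem_filter.1 hi
        have hlx : lev x = lev c := by rw [← hlevrep, hx]
        have hly : lev y = lev (rep (flipBit i c)) := by rw [← hlevrep, hy]
        have hcx : col x = col c := by rw [← hcolrep, hx]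
        have hcy : col y = col (rep (flipBit i c)) := by rw [← hcolrep, hy]
        have := hB x y hxy (by rw [hlx, hly]; exact hr _ hit) (f (rep (flipBit i c)))
          (by rw [hcy]; exact hf _ hit)
        rw [hcx, hlx, hly] at this
        exact this
      have hI : I.card ≤ lev c := by
        calc I.card ≤ (univ.filter fun i : Fin n => i.1 < lev c).card :=
              card_le_card fun i hi => by
                simp only [I, mem_filter] at hi ⊢
                exact ⟨hi.1, hi.2.1⟩
          _ ≤ lev c := by rw [Fin.card_filter_val_lt]; exact min_le_right _ _
      have hcard : (E1 ∪ I.biUnion E2).card < (Fam (col c)).card := by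
        have h1 := card_union_le E1 (I.biUnion E2)
        have h2 : (I.biUnion E2).card ≤ lev c * B (col c) :=
          (card_biUnion_le_card_mul _ _ _ hE2).trans (Nat.mul_le_mul_right _ hI)
        have h3 := hcount c
        change (Finset.image rep _).card + _ ≤ _ at h3
        omega
      obtain ⟨S, hS, hSE⟩ := exists_mem_notMem_of_card_lt_card hcard
      simp only [mem_union, mem_biUnion, not_or, not_exists, not_and] at hSE
      refine ⟨S, hS, ?_⟩
      rintro c' hc' (h | ⟨hadj, hd⟩)
      · by_cases hcc : col c' = col c
        · exact hSE.1 (mem_image.2 ⟨c', mem_filter.2 ⟨hc', hcc⟩, h.symm⟩)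
        · have hdis := hdisj _ _ S (f c') hS (hf c' hc') (Or.inl (Ne.symm hcc))
          rw [← h, disjoint_self_iff_empty] at hdis
          exact (hne _ S hS).ne_empty hdis
      · obtain ⟨x, y, hxy, hx, hy⟩ := hadj
        obtain ⟨i, rfl⟩ := hypercubeGraph_adj_iff.1 hxy
        have hlx : lev x = lev c := by rw [← hlevrep, hx]
        have hly : lev (flipBit i x) = lev c' := by rw [← hlevrep, hy]
        have h1 : c' = rep (flipBit i c) := by
          rw [← hy, ← hx]
          exact hlow x i (by rw [hlx, hly]; exact hr _ hc')
        have hi : i.1 < lev c := by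
          rw [← hlx]
          refine hout x i ?_
          rw [hx, hy]
          exact fun e => hct (e ▸ hc')
        refine hSE.2 i (mem_filter.2 ⟨mem_univ _, hi, h1 ▸ hc', ?_⟩) (mem_filter.2 ⟨hS, ?_⟩)
        · exact ⟨x, _, hxy, hx, hy.trans h1⟩
        · rw [← h1]; exact hd)
  have hmem : ∀ x, rep x ∈ univ.image rep := fun x => mem_image_of_mem _ (mem_univ _)
  have hσF : ∀ x, σ (rep x) ∈ Fam (col x) := fun x => by
    have := hσA _ (hmem x)
    rw [hcolrep] at this
    exact this
  refine exists_embedding_of_sparse_blocks (hypercubeGraph n) G rep σ lev (q := q) ?_ ?_ ?_ ?_ ?_ ?_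
  · intro x; rw [hlevrep]; exact (hlev x).1
  · exact fun x => hind _ _ (hσF x)
  · intro x y hxy
    refine hdisj _ _ _ _ (hσF x) (hσF y) (Or.inr fun e => ?_)
    exact hσ _ (hmem x) _ (hmem y) hxy (Or.inl e)
  · intro x
    have hsub : (univ.filter fun y => (hypercubeGraph n).Adj x y ∧ rep y ≠ rep x) ⊆
        (univ.filter fun i : Fin n => i.1 < lev x).image fun i => flipBit i x := by
      intro y hy
      obtain ⟨-, h1, h2⟩ := mem_filter.1 hy
      obtain ⟨i, rfl⟩ := hypercubeGraph_adj_iff.1 h1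
      exact mem_image_of_mem _ (mem_filter.2 ⟨mem_univ _, hout x i h2⟩)
    calc _ ≤ _ := card_le_card hsub
      _ ≤ _ := card_image_le
      _ ≤ lev x := by rw [Fin.card_filter_val_lt]; exact min_le_right _ _
      _ = _ := (hlevrep x).symm
  · intro x y hadj hxy
    by_contra hlt
    exact hσ _ (hmem x) _ (hmem y) hxy (Or.inr ⟨⟨x, y, hadj, rfl, rfl⟩, not_le.1 hlt⟩)
  · intro x
    have hcls : (univ.filter fun y => rep y = rep x).card = 2 ^ (n - lev x) := by
      rw [← card_cubePrefix_class (hlev x).2 x]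
      congr 1
      ext y
      simp only [mem_filter, mem_univ, true_and]
      constructor
      · intro h
        have hl : lev y = lev x := by rw [← hlevrep y, h, hlevrep]
        change cubePrefix (lev y) y = cubePrefix (lev x) x at h
        rw [hl] at h
        exact h
      · intro h
        exact hrep_eq x y h.symm
    rw [hcls]
    exact hsize x _ (hσF x)

/-! ### Supplies of blocks from a sparse set -/

open Finset in
theorem degreeInto_biUnion {V : Type*} [DecidableEq V] (G : SimpleGraph V) (u : V)
    (F : Finset (Finset V)) (hF : ∀ S ∈ F, ∀ T ∈ F, S ≠ T → Disjoint S T) :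
    degreeInto G u (F.biUnion id) = ∑ S ∈ F, degreeInto G u S := by
  classical
  unfold degreeInto
  rw [filter_biUnion, card_biUnion]
  · rfl
  · intro S hS T hT hne
    exact disjoint_filter_filter (hF S hS T hT hne)

open Finset in
/-- Iterated extraction of edgeless sets of sizes `s (K + 1), …, s h` from `R`. -/
theorem exists_level_slots {V : Type*} [DecidableEq V] (G : SimpleGraph V)
    (hG : ∀ a b c, G.Adj a b → G.Adj a c → ¬ G.Adj b c) (s : ℕ → ℕ) (R : Finset V)
    (K h : ℕ) (hKh : K ≤ h) (hs : ∀ k ∈ Ioc K h, 0 < s k ∧ s k ≤ 2 * s (k + 1))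
    (hR : ∀ v, degreeInto G v R ≤ 2 * s (K + 1)) :
    ∃ (Fam : ℕ → Finset (Finset V)) (Rest : Finset V), Rest ⊆ R ∧
      (∀ k, k ∉ Ioc K h → Fam k = ∅) ∧
      (∀ k, ∀ S ∈ Fam k, S ⊆ R ∧ Disjoint S Rest ∧ S.card = s k ∧ IsEdgeless G S) ∧
      (∀ k l, ∀ S ∈ Fam k, ∀ T ∈ Fam l, (k ≠ l ∨ S ≠ T) → Disjoint S T) ∧
      (∀ k v, degreeInto G v ((Fam k).biUnion id) ≤ 2 * s k) ∧
      (∀ v, degreeInto G v Rest ≤ 2 * s (h + 1)) ∧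
      R.card = ∑ k ∈ Ioc K h, (Fam k).card * s k + Rest.card := by
  induction h, hKh using Nat.le_induction with
  | base =>
    exact ⟨fun _ => ∅, R, subset_rfl, by simp, by simp, by simp, by simp [degreeInto], hR, by simp⟩
  | succ h hKh ih =>
    obtain ⟨Fam, Rest, hRR, h0, h1, h2, h3, h4, h5⟩ := ih fun k hk =>
      hs k (mem_Ioc.2 ⟨(mem_Ioc.1 hk).1, (mem_Ioc.1 hk).2.trans (Nat.le_succ _)⟩)
    have hh : h + 1 ∈ Ioc K (h + 1) := mem_Ioc.2 ⟨by omega, le_rfl⟩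
    obtain ⟨hpos, hdbl⟩ := hs _ hh
    -- Degrees into `F` are bounded by those into `Rest` before extraction, at most `2 * s (h + 1)`.
    -- Afterwards they are below `s (h + 1) ≤ 2 * s (h + 2)`, which restores the invariant.
    obtain ⟨F, hF1, hF2, hF3⟩ := exists_edgeless_family G hG hpos Rest
    have hFsub : F.biUnion id ⊆ Rest := biUnion_subset.2 fun S hS => (hF1 S hS).1
    have hne : ∀ k ∈ Ioc K h, k ≠ h + 1 := fun k hk => by have := (mem_Ioc.1 hk).2; omega
    refine ⟨Function.update Fam (h + 1) F, Rest \ F.biUnion id, sdiff_subset.trans hRR,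
      ?_, ?_, ?_, ?_, ?_, ?_⟩
    · intro k hk
      have hk1 : k ≠ h + 1 := fun e => hk (e ▸ hh)
      rw [Function.update_of_ne hk1]
      refine h0 k fun hk' => hk ?_
      rw [mem_Ioc] at hk' ⊢
      omega
    · intro k S hS
      by_cases hk : k = h + 1
      · subst hk
        rw [Function.update_self] at hS
        obtain ⟨a, b, c⟩ := hF1 S hS
        exact ⟨a.trans hRR, disjoint_sdiff.mono_left
          (subset_biUnion_of_mem id hS), b, c⟩
      · rw [Function.update_of_ne hk] at hS
        obtain ⟨a, b, c⟩ := h1 k S hS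
        exact ⟨a, b.mono_right sdiff_subset, c⟩
    · intro k l S hS T hT hST
      by_cases hk : k = h + 1 <;> by_cases hl : l = h + 1
      · subst hk; subst hl
        rw [Function.update_self] at hS hT
        exact hF2 S hS T hT (hST.resolve_left fun h => h rfl)
      · subst hk
        rw [Function.update_self] at hS
        rw [Function.update_of_ne hl] at hT
        exact ((h1 l T hT).2.1.mono_right (hF1 S hS).1).symm
      · subst hl
        rw [Function.update_self] at hT
        rw [Function.update_of_ne hk] at hS
        exact (h1 k S hS).2.1.mono_right (hF1 T hT).1
      · rw [Function.update_of_ne hk] at hS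
        rw [Function.update_of_ne hl] at hT
        exact h2 k l S hS T hT hST
    · intro k v
      by_cases hk : k = h + 1
      · subst hk
        rw [Function.update_self]
        exact (degreeInto_mono G v hFsub).trans (h4 v)
      · rw [Function.update_of_ne hk]
        exact h3 k v
    · exact fun v => (hF3 v).le.trans hdbl
    · have hcF : (F.biUnion id).card = F.card * s (h + 1) := by
        refine (card_biUnion fun S hS T hT hne => hF2 S hS T hT hne).trans ?_
        exact sum_const_nat fun S hS => (hF1 S hS).2.1
      rw [h5, ← Finset.insert_Ioc_right_eq_Ioc_add_one hKh, sum_insert (by simp),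
        Function.update_self, card_sdiff_of_subset hFsub, hcF]
      have := card_le_card hFsub
      rw [hcF] at this
      have hsum : ∑ k ∈ Ioc K h, (Function.update Fam (h + 1) F k).card * s k =
          ∑ k ∈ Ioc K h, (Fam k).card * s k :=
        sum_congr rfl fun k hk => by rw [Function.update_of_ne (hne k hk)]
      rw [hsum]
      omega

open Finset in
/-- A finite set can be cut into sets of size `s`. -/
theorem exists_disjoint_chunks {V : Type*} [DecidableEq V] {s : ℕ} (hs : 0 < s) (A : Finset V) :
    ∃ F : Finset (Finset V), (∀ S ∈ F, S ⊆ A ∧ S.card = s) ∧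
      (∀ S ∈ F, ∀ T ∈ F, S ≠ T → Disjoint S T) ∧ F.card = A.card / s := by
  induction hm : A.card using Nat.strong_induction_on generalizing A with
  | _ m ih =>
    by_cases hlt : m < s
    · exact ⟨∅, by simp, by simp, by simp [Nat.div_eq_of_lt hlt]⟩
    · obtain ⟨S, hSA, hS⟩ := exists_subset_card_eq (hm ▸ not_lt.1 hlt : s ≤ A.card)
      have hc : (A \ S).card = m - s := by rw [card_sdiff_of_subset hSA, hS, hm]
      obtain ⟨F, h1, h2, h3⟩ := ih (m - s) (by omega) (A \ S) hc
      have hd : ∀ T ∈ F, Disjoint S T := fun T hT => disjoint_sdiff.mono_right (h1 T hT).1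
      have hSF : S ∉ F := fun hSF => by
        have := hd S hSF
        rw [disjoint_self_iff_empty] at this
        rw [this, card_empty] at hS
        omega
      refine ⟨insert S F, ?_, ?_, ?_⟩
      · intro T hT
        rcases mem_insert.1 hT with rfl | hT
        · exact ⟨hSA, hS⟩
        · exact ⟨(h1 T hT).1.trans sdiff_subset, (h1 T hT).2⟩
      · intro T hT T' hT' hne
        rcases mem_insert.1 hT with e | hT <;> rcases mem_insert.1 hT' with e' | hT'
        · exact absurd (e.trans e'.symm) hne
        · exact e ▸ hd _ hT'
        · exact e' ▸ (hd _ hT).symm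
        · exact h2 _ hT _ hT' hne
      · rw [card_insert_of_notMem hSF, h3, Nat.div_eq_sub_div hs (not_lt.1 hlt)]

-- Double counting of edges between `T` and the union of `F`: each vertex of `T` sends at most `D`
-- of them, while each block counted on the left receives more than `s * T.card / c` when `c` is
-- positive.
open Finset in
theorem card_dense_mul_le {V : Type*} [DecidableEq V] (G : SimpleGraph V) (F : Finset (Finset V))
    (hF : ∀ S ∈ F, ∀ T ∈ F, S ≠ T → Disjoint S T) {s D c : ℕ} (hs : ∀ S ∈ F, S.card = s)
    (hD : ∀ v, degreeInto G v (F.biUnion id) ≤ D) (T : Finset V) :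
    (F.filter fun S => S.card * T.card < c * ∑ u ∈ S, degreeInto G u T).card * s ≤ c * D := by
  classical
  rcases T.eq_empty_or_nonempty with rfl | hT
  · simp [degreeInto]
  set E := F.filter fun S => S.card * T.card < c * ∑ u ∈ S, degreeInto G u T
  refine Nat.le_of_mul_le_mul_right ?_ hT.card_pos
  calc E.card * s * T.card = ∑ S ∈ E, S.card * T.card := by
        rw [sum_const_nat (m := s * T.card), mul_assoc]
        intro S hS
        rw [hs S (mem_filter.1 hS).1]
    _ ≤ ∑ S ∈ E, c * ∑ u ∈ T, degreeInto G u S := by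
        refine sum_le_sum fun S hS => ?_
        rw [← sum_degreeInto_comm]
        exact (mem_filter.1 hS).2.le
    _ ≤ ∑ S ∈ F, c * ∑ u ∈ T, degreeInto G u S := sum_le_sum_of_subset (filter_subset _ _)
    _ = c * ∑ u ∈ T, degreeInto G u (F.biUnion id) := by
        rw [← mul_sum, sum_comm]
        simp_rw [degreeInto_biUnion G _ F hF]
    _ ≤ c * ∑ u ∈ T, D := Nat.mul_le_mul_left _ (sum_le_sum fun u _ => hD u)
    _ = c * D * T.card := by rw [sum_const, smul_eq_mul]; ring

open Finset in
/-- Embedding of the cube when part `W` of it is placed in large edgeless sets and the rest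
in a sparse set `R`. -/
theorem exists_embedding_of_chunks_of_sparse {V ι : Type*} [DecidableEq V] [Nonempty V]
    [DecidableEq ι] {n : ℕ} (G : SimpleGraph V)
    (hG : ∀ a b c, G.Adj a b → G.Adj a c → ¬ G.Adj b c) {K h a q : ℕ} (hq : q = 2 ^ a + 1)
    (hK : 0 < K) (hKh : K ≤ h) (hhn : h + a < n)
    (W : Finset (Fin n → Bool)) (hW : PrefixClosed K W) (side : (Fin n → Bool) → ι)
    (hside : ∀ x y, cubePrefix K x = cubePrefix K y → side x = side y)
    (hadj : ∀ x ∈ W, ∀ y ∈ W, (hypercubeGraph n).Adj x y → side x = side y)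
    (A : ι → Finset V) (R : Finset V) (hA : ∀ i, IsEdgeless G (A i))
    (hAA : ∀ i j, i ≠ j → Disjoint (A i) (A j)) (hAR : ∀ i, Disjoint (A i) R)
    (hWA : ∀ i, ((W.filter fun x => side x = i).image (cubePrefix K)).card ≤
      (A i).card / (2 ^ (n - K - a) * q))
    (hR : ∀ v, degreeInto G v R ≤ 2 * (2 ^ (n - (K + 1) - a) * q))
    (hbudget : q * (Wᶜ.card + (∑ k ∈ Ioc K h, k * (8 * q ^ 2 * k ^ 2) * 2 ^ (n - k)
      + n * (8 * q ^ 2 * n ^ 2 * (2 ^ (n - (h + 1) - a) * q)))) ≤ 2 ^ a * R.card) :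
    ∃ f : (Fin n → Bool) → V, Function.Injective f ∧
      ∀ x y, (hypercubeGraph n).Adj x y → ¬ G.Adj (f x) (f y) := by
  classical
  have hq2 : 2 ≤ q := by have := Nat.one_le_two_pow (n := a); omega
  -- For `k ≤ h`, a block for a subcube of codimension `k` exceeds it by the factor `q / 2 ^ a = 1 +
  -- 2 ^ (-a)`.
  let s : ℕ → ℕ := fun k => 2 ^ (n - k - a) * q
  have hs0 : ∀ k, 0 < s k := fun k => by positivity
  have hsq : ∀ k ≤ h, s k * 2 ^ a = 2 ^ (n - k) * q := by
    intro k hk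
    have : n - k = (n - k - a) + a := by omega
    change 2 ^ (n - k - a) * q * 2 ^ a = _
    conv_rhs => rw [this, pow_add]
    ring
  obtain ⟨Fam, Rest, hRR, h0, h1, h2, h3, h4, h5⟩ := exists_level_slots G hG s R K h hKh
    (fun k hk => ⟨hs0 k, by
      have := mem_Ioc.1 hk
      have e : n - k - a = (n - (k + 1) - a) + 1 := by omega
      change 2 ^ (n - k - a) * q ≤ 2 * (2 ^ (n - (k + 1) - a) * q)
      rw [e, pow_succ]
      apply le_of_eq
      ring⟩) hR
  choose Ch hCh1 hCh2 hCh3 using fun i => exists_disjoint_chunks (hs0 K) (A i)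
  -- Blocks are used at codimensions `K + 1, …, h`. Whatever is left of `R` serves single cube
  -- vertices, that is, codimension `n`; the codimensions strictly between have no supply.
  let L : ℕ → Finset (Finset V) := fun k => if k = n then Rest.image fun v => {v} else Fam k
  have hLn : L n = Rest.image fun v => {v} := if_pos rfl
  have hLk : ∀ k, k ≠ n → L k = Fam k := fun k hk => if_neg hk
  let sz : ℕ → ℕ := fun k => if k = n then 1 else s k
  let D : ℕ → ℕ := fun k => if k = n then 2 * s (h + 1) else 2 * s k
  have hLsz : ∀ k, ∀ S ∈ L k, S.card = sz k := by
    intro k S hS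
    by_cases hk : k = n
    · subst hk
      rw [hLn] at hS
      obtain ⟨v, -, rfl⟩ := mem_image.1 hS
      simp [sz]
    · rw [hLk k hk] at hS
      simp only [sz, if_neg hk]
      exact (h1 k S hS).2.2.1
  have hLdisj : ∀ k l, ∀ S ∈ L k, ∀ T ∈ L l, (k ≠ l ∨ S ≠ T) → Disjoint S T := by
    intro k l S hS T hT hST
    by_cases hk : k = n <;> by_cases hl : l = n
    · subst hk; subst hl
      rw [hLn] at hS hT
      obtain ⟨v, -, rfl⟩ := mem_image.1 hS
      obtain ⟨w, -, rfl⟩ := mem_image.1 hT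
      have := hST.resolve_left fun h => h rfl
      rw [disjoint_singleton]
      exact fun e => this (by rw [e])
    · subst hk
      rw [hLn] at hS
      rw [hLk l hl] at hT
      obtain ⟨v, hv, rfl⟩ := mem_image.1 hS
      exact ((h1 l T hT).2.1.mono_right (singleton_subset_iff.2 hv)).symm
    · subst hl
      rw [hLn] at hT
      rw [hLk k hk] at hS
      obtain ⟨v, hv, rfl⟩ := mem_image.1 hT
      exact (h1 k S hS).2.1.mono_right (singleton_subset_iff.2 hv)
    · rw [hLk k hk] at hS
      rw [hLk l hl] at hT
      exact h2 k l S hS T hT hST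
  have hLR : ∀ k, ∀ S ∈ L k, S ⊆ R ∧ IsEdgeless G S := by
    intro k S hS
    by_cases hk : k = n
    · subst hk
      rw [hLn] at hS
      obtain ⟨v, hv, rfl⟩ := mem_image.1 hS
      refine ⟨singleton_subset_iff.2 (hRR hv), ?_⟩
      intro x hx y hy
      rw [mem_singleton.1 hx, mem_singleton.1 hy]
      exact G.loopless.irrefl v
    · rw [hLk k hk] at hS
      exact ⟨(h1 k S hS).1, (h1 k S hS).2.2.2⟩
  have hLD : ∀ k v, degreeInto G v ((L k).biUnion id) ≤ D k := by
    intro k v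
    by_cases hk : k = n
    · subst hk
      have : (L k).biUnion id = Rest := by
        rw [hLn, image_biUnion]
        exact biUnion_singleton_eq_self
      rw [this]
      simp only [D, if_true]
      exact h4 v
    · rw [hLk k hk]
      simp only [D, if_neg hk]
      exact h3 k v
  -- From `card_dense_mul_le` with threshold at most `4 * q ^ 2 * k ^ 2` and degree `2 * s k`: the
  -- block size cancels, except at level `n`, where blocks have size one and degrees are bounded by
  -- `2 * s (h + 1)`.
  let B : ℕ → ℕ := fun k => if k = n then 8 * q ^ 2 * n ^ 2 * s (h + 1) else 8 * q ^ 2 * k ^ 2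
  have hBk : ∀ k j, j ≤ k → ∀ T : Finset V, ((L k).filter fun S => S.card * T.card <
      4 * q ^ 2 * k * j * ∑ u ∈ S, degreeInto G u T).card ≤ B k := by
    intro k j hj T
    have hm := card_dense_mul_le G (L k) (fun S hS T hT hne => hLdisj k k S hS T hT (Or.inr hne))
      (c := 4 * q ^ 2 * k * j) (hLsz k) (hLD k) T
    have hle : 4 * q ^ 2 * k * j * D k ≤ B k * sz k := by
      by_cases hk : k = n
      · simp only [D, B, sz, if_pos hk]
        subst hk
        calc 4 * q ^ 2 * k * j * (2 * s (h + 1)) ≤ 4 * q ^ 2 * k * k * (2 * s (h + 1)) := by gcongr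
          _ = _ := by ring
      · simp only [D, B, sz, if_neg hk]
        calc 4 * q ^ 2 * k * j * (2 * s k) ≤ 4 * q ^ 2 * k * k * (2 * s k) := by gcongr
          _ = _ := by ring
    have hpos : 0 < sz k := by
      by_cases hk : k = n
      · simp [sz, hk]
      · simpa [sz, hk] using hs0 k
    exact Nat.le_of_mul_le_mul_right (hm.trans hle) hpos
  -- Holds back the `k * B k` blocks that the greedy choice may exclude. If the truncated difference
  -- is `0`, the level is simply not used.
  let u : ℕ → ℕ := fun k => (L k).card - k * B k
  have hWc : PrefixClosed K Wᶜ := fun x y hxy hx =>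
    mem_compl.2 fun hy => mem_compl.1 hx (hW y x hxy.symm hy)
  have hhn' : h < n := by omega
  have hcap : Wᶜ.card ≤ ∑ k ∈ Ioc K n, u k * 2 ^ (n - k) := by
    have hsub : insert n (Ioc K h) ⊆ Ioc K n := by
      intro k hk
      rcases mem_insert.1 hk with rfl | hk
      · exact mem_Ioc.2 ⟨by omega, le_rfl⟩
      · have := mem_Ioc.1 hk
        exact mem_Ioc.2 ⟨this.1, by omega⟩
    refine le_trans ?_ (sum_le_sum_of_subset hsub)
    rw [sum_insert (by simp; omega)]
    have hun : Rest.card ≤ u n + n * (8 * q ^ 2 * n ^ 2 * s (h + 1)) := by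
      have : (L n).card = Rest.card := by
        rw [hLn, card_image_of_injective _ singleton_injective]
      simp only [u, B, this, if_true]
      omega
    have huk : ∀ k ∈ Ioc K h, (Fam k).card ≤ u k + k * (8 * q ^ 2 * k ^ 2) := by
      intro k hk
      have hkn : k ≠ n := by have := (mem_Ioc.1 hk).2; omega
      simp only [u, B, if_neg hkn, hLk k hkn]
      omega
    have hsum : ∑ k ∈ Ioc K h, (Fam k).card * s k * 2 ^ a ≤
        q * (∑ k ∈ Ioc K h, u k * 2 ^ (n - k) +
          ∑ k ∈ Ioc K h, k * (8 * q ^ 2 * k ^ 2) * 2 ^ (n - k)) := by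
      rw [← sum_add_distrib, mul_sum]
      refine sum_le_sum fun k hk => ?_
      rw [mul_assoc, hsq k (mem_Ioc.1 hk).2]
      calc (Fam k).card * (2 ^ (n - k) * q)
          ≤ (u k + k * (8 * q ^ 2 * k ^ 2)) * (2 ^ (n - k) * q) :=
            Nat.mul_le_mul_right _ (huk k hk)
        _ = _ := by ring
    have htot : 2 ^ a * R.card ≤ q * (∑ k ∈ Ioc K h, u k * 2 ^ (n - k) +
          ∑ k ∈ Ioc K h, k * (8 * q ^ 2 * k ^ 2) * 2 ^ (n - k)) +
          q * (u n + n * (8 * q ^ 2 * n ^ 2 * s (h + 1))) := by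
      rw [h5, mul_add]
      refine Nat.add_le_add ?_ ?_
      · rw [mul_comm, sum_mul]; exact hsum
      · exact Nat.mul_le_mul (by omega) hun
    have hb := hbudget.trans htot
    have hq0 : 0 < q := by omega
    have hb' : q * (Wᶜ.card + (∑ k ∈ Ioc K h, k * (8 * q ^ 2 * k ^ 2) * 2 ^ (n - k)
      + n * (8 * q ^ 2 * n ^ 2 * s (h + 1)))) ≤ q * (∑ k ∈ Ioc K h, u k * 2 ^ (n - k) +
          ∑ k ∈ Ioc K h, k * (8 * q ^ 2 * k ^ 2) * 2 ^ (n - k) +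
          (u n + n * (8 * q ^ 2 * n ^ 2 * s (h + 1)))) := by
      rw [mul_add q (_ + _)]
      exact hb
    have := Nat.le_of_mul_le_mul_left hb' hq0
    simp only [Nat.sub_self, pow_zero, mul_one]
    omega
  obtain ⟨lev', hlev1, hlev2⟩ := exists_level_function u K (by omega) Wᶜ hWc hcap
  let lev : (Fin n → Bool) → ℕ := fun x => if x ∈ W then K else lev' x
  have hlevW : ∀ x ∈ W, lev x = K := fun x hx => if_pos hx
  have hlevW' : ∀ x, x ∉ W → lev x = lev' x := fun x hx => if_neg hx
  have hlevI : ∀ x, x ∉ W → lev x ∈ Ioc K n := fun x hx => by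
    rw [hlevW' x hx]; exact hlev1 x (mem_compl.2 hx)
  have hsame : ∀ x y, cubePrefix (lev x) x = cubePrefix (lev x) y →
      (x ∈ W ∧ y ∈ W) ∨ (x ∉ W ∧ y ∉ W ∧ lev y = lev x) := by
    intro x y hxy
    by_cases hx : x ∈ W
    · rw [hlevW x hx] at hxy
      exact Or.inl ⟨hx, hW x y hxy hx⟩
    · have := (hlev2 _ (hlevI x hx)).1 x y hxy
        (mem_filter.2 ⟨mem_compl.2 hx, (hlevW' x hx).symm⟩)
      obtain ⟨h1, h2⟩ := mem_filter.1 this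
      have hy := mem_compl.1 h1
      exact Or.inr ⟨hx, hy, by rw [hlevW' y hy, h2]⟩
  let col : (Fin n → Bool) → ι ⊕ ℕ := fun x => if x ∈ W then Sum.inl (side x) else Sum.inr (lev x)
  have hcolW : ∀ x ∈ W, col x = Sum.inl (side x) := fun x hx => if_pos hx
  have hcolW' : ∀ x, x ∉ W → col x = Sum.inr (lev x) := fun x hx => if_neg hx
  refine exists_embedding_of_levels G (q := q) lev ?_ ?_ col ?_ (Sum.elim Ch L) ?_ ?_ ?_ ?_
    (Sum.elim (fun _ => 0) B) ?_ ?_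
  · intro x
    by_cases hx : x ∈ W
    · rw [hlevW x hx]; omega
    · have := mem_Ioc.1 (hlevI x hx); omega
  · intro x y hxy
    rcases hsame x y hxy with ⟨hx, hy⟩ | ⟨hx, hy, h⟩
    · rw [hlevW x hx, hlevW y hy]
    · exact h
  · intro x y hxy
    rcases hsame x y hxy with ⟨hx, hy⟩ | ⟨hx, hy, h⟩
    · rw [hlevW x hx] at hxy
      rw [hcolW x hx, hcolW y hy, hside x y hxy]
    · rw [hcolW' x hx, hcolW' y hy, h]
  · rintro (i | k) (j | l) S T hS hT hST
    · by_cases hij : i = j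
      · subst hij
        exact hCh2 i S hS T hT (hST.resolve_left fun h => h rfl)
      · exact (hAA i j hij).mono (hCh1 i S hS).1 (hCh1 j T hT).1
    · exact (hAR i).mono (hCh1 i S hS).1 (hLR l T hT).1
    · exact ((hAR j).mono (hCh1 j T hT).1 (hLR k S hS).1).symm
    · refine hLdisj k l S hS T hT (hST.imp_left fun h e => h (by rw [e]))
  · rintro (i | k) S hS
    · rw [← card_pos, (hCh1 i S hS).2]; exact hs0 K
    · rw [← card_pos, hLsz k S hS]
      by_cases hk : k = n
      · simp [sz, hk]
      · simpa [sz, hk] using hs0 k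
  · rintro (i | k) S hS
    · exact (hA i).subset (hCh1 i S hS).1
    · exact (hLR k S hS).2
  · intro x S hS
    have hgen : ∀ k ≤ h, 2 ^ (n - k) * q + s k < (s k + 1) * q := by
      intro k hk
      rw [← hsq k hk]
      have : (s k + 1) * q = s k * 2 ^ a + s k + q := by
        conv_lhs => rw [hq]
        rw [hq]; ring
      omega
    by_cases hx : x ∈ W
    · rw [hcolW x hx] at hS
      rw [(hCh1 _ S hS).2, hlevW x hx]
      exact hgen K hKh
    · rw [hcolW' x hx] at hS
      by_cases hk : lev x = n
      · rw [hLsz _ S hS]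
        simp only [sz, hk, if_true, Nat.sub_self]
        omega
      · have hS' := hS
        simp only [Sum.elim_inr, hLk _ hk] at hS'
        rw [(h1 _ S hS').2.2.1]
        refine hgen _ ?_
        by_contra hlt
        have : lev x ∉ Ioc K h := fun hm => hlt (mem_Ioc.1 hm).2
        rw [h0 _ this] at hS'
        simp at hS'
  · intro x y hxy hle T hT
    by_cases hx : x ∈ W
    · have hy : y ∈ W := by
        by_contra hy
        have := (mem_Ioc.1 (hlevI y hy)).1
        rw [hlevW x hx] at hle
        omega
      rw [hcolW y hy, ← hadj x hx y hy hxy] at hT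
      rw [hcolW x hx]
      simp only [Sum.elim_inl, Nat.le_zero, card_eq_zero, filter_eq_empty_iff, not_lt]
      intro S hS
      have : ∑ u ∈ S, degreeInto G u T = 0 := sum_eq_zero fun u hu =>
        (hA _).degreeInto_eq_zero ((hCh1 _ S hS).1 hu) (hCh1 _ T hT).1
      rw [this]
      simp
    · rw [hcolW' x hx]
      exact hBk _ _ hle T
  · intro x
    by_cases hx : x ∈ W
    · rw [hcolW x hx]
      simp only [Sum.elim_inl, mul_zero, add_zero]
      rw [hCh3]
      refine le_trans (card_le_card ?_) (hWA (side x))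
      intro z hz
      obtain ⟨y, hy, rfl⟩ := mem_image.1 hz
      have hcy := (mem_filter.1 hy).2
      have hyW : y ∈ W := by
        by_contra hyW
        rw [hcolW' y hyW] at hcy
        simp at hcy
      rw [hcolW y hyW] at hcy
      rw [hlevW y hyW]
      exact mem_image_of_mem _ (mem_filter.2 ⟨hyW, Sum.inl_injective hcy⟩)
    · rw [hcolW' x hx]
      simp only [Sum.elim_inr]
      have hsub : ((univ.filter fun y => col y = Sum.inr (lev x)).image
          fun y => cubePrefix (lev y) y) ⊆
          (Wᶜ.filter fun y => lev' y = lev x).image (cubePrefix (lev x)) := by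
        intro z hz
        obtain ⟨y, hy, rfl⟩ := mem_image.1 hz
        have hcy := (mem_filter.1 hy).2
        have hyW : y ∉ W := by
          intro hyW
          rw [hcolW y hyW] at hcy
          simp at hcy
        rw [hcolW' y hyW] at hcy
        have hl : lev y = lev x := Sum.inr_injective hcy
        rw [hl]
        exact mem_image_of_mem _ (mem_filter.2 ⟨mem_compl.2 hyW, by rw [← hlevW' y hyW, hl]⟩)
      have h6 := card_le_card hsub
      have h7 := (hlev2 _ (hlevI x hx)).2
      have h8 : 0 < ((univ.filter fun y => col y = Sum.inr (lev x)).image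
          fun y => cubePrefix (lev y) y).card :=
        card_pos.2 ⟨_, mem_image_of_mem _ (mem_filter.2 ⟨mem_univ x, hcolW' x hx⟩)⟩
      simp only [u] at h7
      omega

/-! ### Cutting the cube along weight layers -/

open Finset in
/-- Cut the range of a weight function into intervals of prescribed sizes, up to one layer each. -/
theorem exists_cut_points {X : Type*} [Fintype X] (w : X → ℕ) {l M : ℕ}
    (hl : ∀ j, (univ.filter fun x => w x = j).card ≤ l) (c : ℕ → ℕ) :
    ∃ e : ℕ → ℕ, e 0 = 0 ∧ StrictMono e ∧ ∀ i,
      (univ.filter fun x => e i ≤ w x ∧ w x + 1 < e (i + 1)).card ≤ c i ∧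
      (M ≤ e (i + 1) ∨ c i ≤ (univ.filter fun x => e i ≤ w x ∧ w x + 1 < e (i + 1)).card + l) := by
  classical
  have step : ∀ i p, ∃ p', p < p' ∧
      (univ.filter fun x => p ≤ w x ∧ w x + 1 < p').card ≤ c i ∧
      (M ≤ p' ∨ c i ≤ (univ.filter fun x => p ≤ w x ∧ w x + 1 < p').card + l) := by
    intro i p
    let P : ℕ → Prop := fun b => (univ.filter fun x => p ≤ w x ∧ w x < b).card ≤ c i
    have hP : P p := by
      have : (univ.filter fun x => p ≤ w x ∧ w x < p) = ∅ := by
        rw [filter_eq_empty_iff]; intro x _; omega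
      simp [P, this]
    -- The interval fills up with the layers `p, …, b - 1`. The cut is at `b + 1`, so layer `b`
    -- becomes the dropped layer.
    let b := Nat.findGreatest P (max M p)
    have hpb : p ≤ b := Nat.le_findGreatest (le_max_right _ _) hP
    have hb : P b := Nat.findGreatest_spec (le_max_right _ _) hP
    refine ⟨b + 1, by omega, by simpa [P] using hb, ?_⟩
    rcases (Nat.findGreatest_le (P := P) (max M p)).lt_or_eq with hlt | heq
    · right
      have hnb : ¬ P (b + 1) := Nat.findGreatest_is_greatest (Nat.lt_succ_self _) hlt
      have hsub : (univ.filter fun x => p ≤ w x ∧ w x < b + 1) ⊆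
          (univ.filter fun x => p ≤ w x ∧ w x + 1 < b + 1) ∪ univ.filter fun x => w x = b := by
        intro x hx
        simp only [mem_union, mem_filter, mem_univ, true_and] at hx ⊢
        omega
      have h1 := (card_le_card hsub).trans (card_union_le _ _)
      have h2 := hl b
      have h3 := not_le.1 hnb
      omega
    · left
      have : M ≤ b := (le_max_left M p).trans heq.ge
      omega
  choose g hg1 hg2 using step
  let e : ℕ → ℕ := fun i => Nat.rec 0 (fun i p => g i p) i
  exact ⟨e, rfl, strictMono_nat_of_lt_succ fun i => hg1 i (e i), fun i => hg2 i (e i)⟩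

theorem exists_mem_cut_interval {e : ℕ → ℕ} (h0 : e 0 = 0) (he : StrictMono e) (j : ℕ) :
    ∃ i, e i ≤ j ∧ j < e (i + 1) := by
  refine ⟨Nat.findGreatest (fun i => e i ≤ j) j, ?_, ?_⟩
  · exact Nat.findGreatest_spec (P := fun i => e i ≤ j) (Nat.zero_le j) (by omega)
  · by_contra hlt
    have h1 := not_lt.1 hlt
    have h2 := he.id_le (Nat.findGreatest (fun i => e i ≤ j) j + 1)
    have h3 : Nat.findGreatest (fun i => e i ≤ j) j + 1 ≤ j := h2.trans h1
    have := Nat.le_findGreatest (P := fun i => e i ≤ j) h3 h1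
    omega

theorem cut_interval_unique {e : ℕ → ℕ} (he : StrictMono e) {i j x y : ℕ} (hi : e i ≤ x)
    (hj : y < e (j + 1)) (hxy : x ≤ y) : i ≤ j :=
  Nat.lt_succ_iff.1 (he.lt_iff_lt.1 (hi.trans_lt (hxy.trans_lt hj)))

open Finset in
/-- The uncovered part after cutting into `m` intervals with one layer dropped after each. -/
theorem card_compl_cut_intervals_le {X : Type*} [Fintype X] [DecidableEq X] (w : X → ℕ) {l M : ℕ}
    (hw : ∀ x, w x < M) (hl : ∀ j, (univ.filter fun x => w x = j).card ≤ l) (c e : ℕ → ℕ)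
    (he0 : e 0 = 0) (he : StrictMono e)
    (hec : ∀ i, (M ≤ e (i + 1) ∨
      c i ≤ (univ.filter fun x => e i ≤ w x ∧ w x + 1 < e (i + 1)).card + l)) (m : ℕ) :
    ((range m).biUnion fun i => univ.filter fun x => e i ≤ w x ∧ w x + 1 < e (i + 1))ᶜ.card ≤
      (Fintype.card X - ∑ i ∈ range m, c i) + 2 * m * l := by
  set D : ℕ → Finset X := fun i => univ.filter fun x => e i ≤ w x ∧ w x + 1 < e (i + 1) with hD
  -- If the cuts get past all weights, only dropped layers are uncovered. Otherwise every interval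
  -- is full up to one layer.
  by_cases hM : ∃ i < m, M ≤ e (i + 1)
  · obtain ⟨i, him, hi⟩ := hM
    have hsub : ((range m).biUnion D)ᶜ ⊆
        (range m).biUnion fun i => univ.filter fun x => w x = e (i + 1) - 1 := by
      intro x hx
      obtain ⟨j, hj1, hj2⟩ := exists_mem_cut_interval he0 he (w x)
      have hjm : j < m := by
        have h1 : e j < e m := hj1.trans_lt ((hw x).trans_le (hi.trans (he.monotone him)))
        exact he.lt_iff_lt.1 h1
      refine mem_biUnion.2 ⟨j, mem_range.2 hjm, mem_filter.2 ⟨mem_univ _, ?_⟩⟩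
      by_contra hne
      refine mem_compl.1 hx (mem_biUnion.2 ⟨j, mem_range.2 hjm, mem_filter.2 ⟨mem_univ _, hj1, ?_⟩⟩)
      omega
    have h1 := (card_le_card hsub).trans (card_biUnion_le_card_mul _ _ l fun i _ => hl _)
    rw [card_range] at h1
    nlinarith [Nat.zero_le (Fintype.card X - ∑ i ∈ range m, c i), Nat.zero_le (m * l)]
  · push Not at hM
    have hdis : ∀ i ∈ range m, ∀ j ∈ range m, i ≠ j → Disjoint (D i) (D j) := by
      intro i _ j _ hij
      rw [disjoint_left]
      intro x hx hy
      obtain ⟨-, h1, h2⟩ := mem_filter.1 hx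
      obtain ⟨-, h3, h4⟩ := mem_filter.1 hy
      exact hij (le_antisymm (cut_interval_unique he h1 (by omega : w x < e (j + 1)) le_rfl)
        (cut_interval_unique he h3 (by omega : w x < e (i + 1)) le_rfl))
    have h1 : ∑ i ∈ range m, c i ≤ ((range m).biUnion D).card + m * l := by
      rw [card_biUnion hdis]
      calc ∑ i ∈ range m, c i ≤ ∑ i ∈ range m, ((D i).card + l) := sum_le_sum fun i hi =>
            (hec i).resolve_left (not_le.2 (hM i (mem_range.1 hi)))
        _ = _ := by rw [sum_add_distrib, sum_const, card_range, smul_eq_mul]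
    rw [card_compl]
    have h2 : 2 * m * l = m * l + m * l := by ring
    omega

open Finset in
/-- The number of ones among the first `K` coordinates. -/
def cubeWeight {n : ℕ} (K : ℕ) (x : Fin n → Bool) : ℕ :=
  (univ.filter fun i : Fin n => i.1 < K ∧ x i = true).card

theorem cubeWeight_congr {n K : ℕ} {x y : Fin n → Bool} (h : cubePrefix K x = cubePrefix K y) :
    cubeWeight K x = cubeWeight K y := by
  unfold cubeWeight
  congr 1
  ext i
  simp only [Finset.mem_filter, Finset.mem_univ, true_and]
  refine and_congr_right fun hi => ?_
  rw [cubePrefix_eq_iff.1 h i hi]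

open Finset in
theorem cubeWeight_le {n K : ℕ} (x : Fin n → Bool) : cubeWeight K x ≤ K :=
  calc cubeWeight K x ≤ (univ.filter fun i : Fin n => i.1 < K).card :=
        card_le_card fun i hi => by
          simp only [mem_filter] at hi ⊢
          exact ⟨hi.1, hi.2.1⟩
    _ ≤ K := by rw [Fin.card_filter_val_lt]; exact min_le_right _ _

open Finset in
theorem cubeWeight_le_of_adj {n K : ℕ} {x y : Fin n → Bool} (h : (hypercubeGraph n).Adj x y) :
    cubeWeight K y ≤ cubeWeight K x + 1 := by
  obtain ⟨i, rfl⟩ := hypercubeGraph_adj_iff.1 h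
  refine le_trans (card_le_card ?_) (card_insert_le i _)
  intro j hj
  by_cases hji : j = i
  · simp [hji]
  · simp only [mem_filter, mem_univ, true_and, mem_insert, hji, false_or] at hj ⊢
    simpa [hji, flipBit] using hj

open Finset in
theorem card_cubeWeight_eq_le {n K : ℕ} (hK : K ≤ n) (j : ℕ) :
    (univ.filter fun x : Fin n → Bool => cubeWeight K x = j).card ≤ K.choose j * 2 ^ (n - K) := by
  have hcl : PrefixClosed K (univ.filter fun x : Fin n → Bool => cubeWeight K x = j) := by
    intro x y hxy hx
    rw [mem_filter] at hx ⊢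
    exact ⟨mem_univ _, by rw [← cubeWeight_congr hxy]; exact hx.2⟩
  rw [hcl.card hK]
  refine Nat.mul_le_mul_right _ ?_
  have hcK : (univ.filter fun i : Fin n => i.1 < K).card = K := by
    rw [Fin.card_filter_val_lt]; omega
  have : ((univ.filter fun i : Fin n => i.1 < K).powersetCard j).card = K.choose j := by
    rw [card_powersetCard, hcK]
  rw [← this]
  refine card_le_card_of_injOn (fun z => univ.filter fun i : Fin n => i.1 < K ∧ z i = true) ?_ ?_
  · intro z hz
    obtain ⟨x, hx, rfl⟩ := mem_image.1 (mem_coe.1 hz)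
    refine mem_coe.2 (mem_powersetCard.2 ⟨fun i hi => ?_, ?_⟩)
    · simp only [mem_filter] at hi ⊢
      exact ⟨hi.1, hi.2.1⟩
    · rw [← (mem_filter.1 hx).2]
      exact cubeWeight_congr (cubePrefix_cubePrefix K x)
  · intro z hz z' hz' h
    obtain ⟨x, hx, rfl⟩ := mem_image.1 (mem_coe.1 hz)
    obtain ⟨y, hy, rfl⟩ := mem_image.1 (mem_coe.1 hz')
    rw [cubePrefix_eq_iff]
    intro i hi
    have := Finset.ext_iff.1 h i
    simp only [mem_filter, mem_univ, true_and, hi] at this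
    simp only [hi, cubePrefix, if_true] at this
    exact Bool.eq_iff_iff.2 this

-- An edge of the cube changes the weight by at most one, so intervals separated by a dropped layer
-- have no edges between them, and nothing is required of `G` between different sets `A i`. Dropped
-- layers and the overflow go to `R`, which is why `2 * m * (C * 2 ^ (n - K))` enters the budget.
open Finset in
theorem exists_embedding_of_edgeless_sets_of_sparse {V : Type*} [DecidableEq V] [Nonempty V]
    {n : ℕ} (G : SimpleGraph V)
    (hG : ∀ a b c, G.Adj a b → G.Adj a c → ¬ G.Adj b c) {K h a q m C : ℕ} (hq : q = 2 ^ a + 1)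
    (hK : 0 < K) (hKh : K ≤ h) (hhn : h + a < n)
    (A : ℕ → Finset V) (R : Finset V) (hA : ∀ i, IsEdgeless G (A i))
    (hAA : ∀ i j, i ≠ j → Disjoint (A i) (A j)) (hAR : ∀ i, Disjoint (A i) R)
    (hC : ∀ j, K.choose j ≤ C)
    (hR : ∀ v, degreeInto G v R ≤ 2 * (2 ^ (n - (K + 1) - a) * q))
    (hbudget : q * ((2 ^ n - ∑ i ∈ range m, (A i).card / (2 ^ (n - K - a) * q) * 2 ^ (n - K))
      + 2 * m * (C * 2 ^ (n - K)) + (∑ k ∈ Ioc K h, k * (8 * q ^ 2 * k ^ 2) * 2 ^ (n - k)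
      + n * (8 * q ^ 2 * n ^ 2 * (2 ^ (n - (h + 1) - a) * q)))) ≤ 2 ^ a * R.card) :
    ∃ f : (Fin n → Bool) → V, Function.Injective f ∧
      ∀ x y, (hypercubeGraph n).Adj x y → ¬ G.Adj (f x) (f y) := by
  classical
  have hKn : K ≤ n := by omega
  have hl : ∀ j, (univ.filter fun x : Fin n → Bool => cubeWeight K x = j).card ≤
      C * 2 ^ (n - K) := fun j =>
    (card_cubeWeight_eq_le hKn j).trans (Nat.mul_le_mul_right _ (hC j))
  let c : ℕ → ℕ := fun i => (A i).card / (2 ^ (n - K - a) * q) * 2 ^ (n - K)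
  obtain ⟨e, he0, he, hec⟩ := exists_cut_points (M := K + 1) _ hl c
  have hcov := card_compl_cut_intervals_le _ (fun x => Nat.lt_succ_of_le (cubeWeight_le x)) hl c e
    he0 he (fun i => (hec i).2) m
  set D : ℕ → Finset (Fin n → Bool) := fun i =>
    univ.filter fun x => e i ≤ cubeWeight K x ∧ cubeWeight K x + 1 < e (i + 1) with hD
  have hDcl : ∀ i, PrefixClosed K (D i) := by
    intro i x y hxy hx
    rw [hD, mem_filter] at hx ⊢
    rw [← cubeWeight_congr hxy]
    exact ⟨mem_univ _, hx.2⟩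
  choose side hside1 hside2 using exists_mem_cut_interval he0 he
  have hsideD : ∀ i, ∀ x ∈ D i, side (cubeWeight K x) = i := by
    intro i x hx
    obtain ⟨-, h1, h2⟩ := mem_filter.1 hx
    exact le_antisymm
      (cut_interval_unique he (hside1 _) (by omega : cubeWeight K x < e (i + 1)) le_rfl)
      (cut_interval_unique he h1 (hside2 _) le_rfl)
  refine exists_embedding_of_chunks_of_sparse G hG hq hK hKh hhn ((range m).biUnion D) ?_
    (fun x => side (cubeWeight K x)) ?_ ?_ A R hA hAA hAR ?_ hR ?_
  · intro x y hxy hx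
    obtain ⟨i, hi, hxi⟩ := mem_biUnion.1 hx
    exact mem_biUnion.2 ⟨i, hi, hDcl i x y hxy hxi⟩
  · intro x y hxy
    rw [cubeWeight_congr hxy]
  · have key : ∀ x y i j, x ∈ D i → y ∈ D j → (hypercubeGraph n).Adj x y → i ≤ j := by
      intro x y i j hx hy hxy
      obtain ⟨-, h1, h2⟩ := mem_filter.1 hx
      obtain ⟨-, h3, h4⟩ := mem_filter.1 hy
      have h5 := cubeWeight_le_of_adj (K := K) hxy.symm
      exact cut_interval_unique he h1 (by omega : cubeWeight K y + 1 < e (j + 1)) h5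
    intro x hx y hy hxy
    obtain ⟨i, -, hxi⟩ := mem_biUnion.1 hx
    obtain ⟨j, -, hyj⟩ := mem_biUnion.1 hy
    rw [hsideD i x hxi, hsideD j y hyj]
    exact le_antisymm (key x y i j hxi hyj hxy) (key y x j i hyj hxi hxy.symm)
  · intro i
    have hsub : ((range m).biUnion D).filter (fun x => side (cubeWeight K x) = i) ⊆ D i := by
      intro x hx
      obtain ⟨h1, h2⟩ := mem_filter.1 hx
      obtain ⟨j, -, hj⟩ := mem_biUnion.1 h1
      rw [← h2, hsideD j x hj]
      exact hj
    refine (card_le_card (image_subset_image hsub)).trans ?_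
    have h1 := (hDcl i).card hKn
    have h2 := (hec i).1
    change (D i).card ≤ _ at h2
    rw [h1] at h2
    exact Nat.le_of_mul_le_mul_right h2 (by positivity)
  · refine le_trans (Nat.mul_le_mul_left _ (Nat.add_le_add_right ?_ _)) hbudget
    have hX : Fintype.card (Fin n → Bool) = 2 ^ n := by simp
    rw [hX] at hcov
    exact hcov

/-! ### Estimates, and the case of a substantial sparse part -/

/-- The induction step reduces to `(2 * j + 1) * (2 * j + 3) ≤ 4 * (j + 1) ^ 2`. It serves to show
that a single weight layer is a vanishing proportion of the cube. -/
theorem centralBinom_sq_mul_le (j : ℕ) : j.centralBinom ^ 2 * (2 * j + 1) ≤ 16 ^ j := by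
  induction j with
  | zero => simp
  | succ j ih =>
    have h := Nat.succ_mul_centralBinom_succ j
    refine le_of_mul_le_mul_left (a := (j + 1) ^ 2) ?_ (by positivity)
    calc (j + 1) ^ 2 * ((j + 1).centralBinom ^ 2 * (2 * (j + 1) + 1))
        = ((j + 1) * (j + 1).centralBinom) ^ 2 * (2 * j + 3) := by ring
      _ = (j.centralBinom ^ 2 * (2 * j + 1)) * (4 * (2 * j + 1) * (2 * j + 3)) := by rw [h]; ring
      _ ≤ 16 ^ j * (4 * (2 * j + 1) * (2 * j + 3)) := Nat.mul_le_mul_right _ ih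
      _ ≤ 16 ^ j * (16 * (j + 1) ^ 2) := Nat.mul_le_mul_left _ (by nlinarith)
      _ = (j + 1) ^ 2 * 16 ^ (j + 1) := by ring

theorem eventually_centralBinom_le {δ : ℝ} (hδ : 0 < δ) :
    ∀ᶠ j : ℕ in atTop, (j.centralBinom : ℝ) ≤ δ * 4 ^ j := by
  filter_upwards [eventually_ge_atTop ⌈1 / δ ^ 2⌉₊] with j hj
  have h1 : 1 / δ ^ 2 ≤ (j : ℝ) := (Nat.le_ceil _).trans (by exact_mod_cast hj)
  have h2 : (j.centralBinom : ℝ) ^ 2 * (2 * j + 1) ≤ 16 ^ j := by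
    exact_mod_cast centralBinom_sq_mul_le j
  rw [div_le_iff₀ (pow_pos hδ 2)] at h1
  have hpos : 0 ≤ δ * 4 ^ j := by positivity
  refine (abs_le_of_sq_le_sq' ?_ hpos).2
  have h16 : (16 : ℝ) ^ j = (4 ^ j) ^ 2 := by rw [← pow_mul, mul_comm, pow_mul]; norm_num
  rw [h16] at h2
  rw [mul_pow]
  have hc : (0 : ℝ) ≤ (j.centralBinom : ℝ) ^ 2 := by positivity
  calc (j.centralBinom : ℝ) ^ 2 ≤ (j.centralBinom : ℝ) ^ 2 * (j * δ ^ 2) :=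
        le_mul_of_one_le_right hc h1
    _ = δ ^ 2 * ((j.centralBinom : ℝ) ^ 2 * j) := by ring
    _ ≤ δ ^ 2 * ((j.centralBinom : ℝ) ^ 2 * (2 * j + 1)) := by
        gcongr
        have : (0 : ℝ) ≤ j := by positivity
        linarith
    _ ≤ δ ^ 2 * (4 ^ j) ^ 2 := by gcongr

open Finset in
theorem exists_forall_sum_Ioc_le {δ : ℝ} (hδ : 0 < δ) :
    ∃ K₁ : ℕ, ∀ K ≥ K₁, ∀ h, ∑ k ∈ Ioc K h, (k : ℝ) ^ 3 * (1 / 2) ^ k ≤ δ := by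
  have hs : Summable fun k : ℕ => (k : ℝ) ^ 3 * (1 / 2) ^ k :=
    summable_pow_mul_geometric_of_norm_lt_one 3 (by norm_num)
  obtain ⟨s, hs⟩ := summable_iff_vanishing_norm.1 hs δ hδ
  refine ⟨s.sup id, fun K hK h => ?_⟩
  have hd : Disjoint (Ioc K h) s := by
    rw [disjoint_left]
    intro k hk hks
    have h1 : k ≤ s.sup id := le_sup (f := id) hks
    have h2 := (mem_Ioc.1 hk).1
    omega
  exact (le_abs_self _).trans (hs _ hd).le

theorem eventually_cube_mul_le {c δ : ℝ} (hδ : 0 < δ) :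
    ∀ᶠ n : ℕ in atTop, c * (n : ℝ) ^ 3 ≤ δ * 2 ^ (n / 2 + 1) := by
  have h1 := tendsto_pow_const_div_const_pow_of_one_lt 3 (show (1 : ℝ) < 2 by norm_num)
  have h2 : Tendsto (fun n : ℕ => n / 2 + 1) atTop atTop :=
    (tendsto_add_atTop_nat 1).comp (Nat.tendsto_div_const_atTop two_ne_zero)
  have h3 := (h1.comp h2).const_mul (8 * |c|)
  rw [mul_zero] at h3
  filter_upwards [h3.eventually (gt_mem_nhds hδ)] with n hn
  simp only [Function.comp] at hn
  have hp : (0 : ℝ) < 2 ^ (n / 2 + 1) := by positivity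
  rw [← mul_div_assoc, div_lt_iff₀ hp] at hn
  refine le_trans ?_ hn.le
  have h4 : (n : ℝ) ≤ 2 * ((n / 2 + 1 : ℕ) : ℝ) := by
    have : n ≤ 2 * (n / 2 + 1) := by omega
    exact_mod_cast this
  calc c * (n : ℝ) ^ 3 ≤ |c| * (2 * ((n / 2 + 1 : ℕ) : ℝ)) ^ 3 := by
        gcongr
        exact le_abs_self c
    _ = _ := by ring

open Finset in
/-- Embedding of the cube when a bounded number of edgeless sets together with a
sparse set `R` of positive density contain slightly more than `2 ^ n` vertices. -/
theorem exists_embedding_of_card_sparse_ge {ε : ℝ} (hε : 0 < ε) (hε1 : ε ≤ 1) (M : ℕ) :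
    ∃ K, ∃ n₀, ∀ n ≥ n₀, ∀ (V : Type) [DecidableEq V] (G : SimpleGraph V),
      (∀ a b c, G.Adj a b → G.Adj a c → ¬ G.Adj b c) →
      ∀ (F : Finset (Finset V)) (R : Finset V), (∀ S ∈ F, IsEdgeless G S) →
      (∀ S ∈ F, ∀ T ∈ F, S ≠ T → Disjoint S T) → (∀ S ∈ F, Disjoint S R) → F.card ≤ M →
      (∀ v, degreeInto G v R ≤ 2 ^ (n - K)) → ε / 4 * 2 ^ n ≤ (R.card : ℝ) →
      (1 + ε) * 2 ^ n ≤ (∑ S ∈ F, (S.card : ℝ)) + R.card →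
      ∃ f : (Fin n → Bool) → V, Function.Injective f ∧
        ∀ x y, (hypercubeGraph n).Adj x y → ¬ G.Adj (f x) (f y) := by
  -- Blocks exceed their subcubes by the proportion `2 ^ (-a) < ε / 4`.
  obtain ⟨a, ha⟩ := exists_pow_lt_of_lt_one (show 0 < ε / 4 by positivity)
    (show (1 / 2 : ℝ) < 1 by norm_num)
  obtain ⟨q, hq⟩ : ∃ q, q = 2 ^ a + 1 := ⟨_, rfl⟩
  have hq0 : 0 < q := by rw [hq]; positivity
  have hqR : (q : ℝ) = 2 ^ a + 1 := by rw [hq]; push_cast; ring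
  have hqpos : (0 : ℝ) < q := by exact_mod_cast hq0
  set δ : ℝ := ε / 32 with hδ
  have hδ0 : 0 < δ := by positivity
  obtain ⟨K₁, hK₁⟩ := exists_forall_sum_Ioc_le (show 0 < δ / (8 * q ^ 2) by positivity)
  have hev1 := eventually_centralBinom_le (show 0 < δ / (2 * M + 1) by positivity)
  have hev2 : ∀ᶠ j : ℕ in atTop, (M : ℝ) ≤ δ * 4 ^ j := by
    have := (tendsto_pow_atTop_atTop_of_one_lt (show (1 : ℝ) < 4 by norm_num)).const_mul_atTop hδ0
    exact this.eventually_ge_atTop _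
  -- With `K = 2 * j`, large `j` makes three losses small: dropped layers, rounding of each set to
  -- whole chunks, and excluded blocks beyond level `K`.
  obtain ⟨j, hj1, hj2, hjK, hj0⟩ := (hev1.and (hev2.and
    ((eventually_ge_atTop K₁).and (eventually_ge_atTop 1)))).exists
  obtain ⟨n₁, hn₁⟩ := eventually_atTop.1 (eventually_cube_mul_le (c := 8 * (q : ℝ) ^ 3) hδ0)
  refine ⟨2 * j, max n₁ (2 * (2 * j + a + 2)), ?_⟩
  intro n hn V _ G hG F R hF1 hF2 hF3 hFM hR hRε htot
  have hn1 : n₁ ≤ n := (le_max_left _ _).trans hn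
  have hn2 : 2 * (2 * j + a + 2) ≤ n := (le_max_right _ _).trans hn
  set K := 2 * j with hK
  -- Stopping the blocks halfway leaves degrees of order `2 ^ (n / 2)`, so placing the remaining
  -- vertices singly costs about `n ^ 3 * 2 ^ (n / 2)`, negligible against `2 ^ n`.
  set h := n / 2 with hh
  have hKh : K ≤ h := by omega
  have hhn : h + a < n := by omega
  have hN : (0 : ℝ) < 2 ^ n := by positivity
  have hRne : R.Nonempty := by
    rw [← card_pos]
    have : (0 : ℝ) < R.card := lt_of_lt_of_le (by positivity) hRε
    exact_mod_cast this
  have : Nonempty V := ⟨hRne.choose⟩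
  set m := F.card with hm
  let en := F.equivFin
  let A : ℕ → Finset V := fun i => if hi : i < m then (en.symm ⟨i, hi⟩ : Finset V) else ∅
  have hAF : ∀ i, ∀ hi : i < m, A i = (en.symm ⟨i, hi⟩ : Finset V) := fun i hi => dif_pos hi
  have hA0 : ∀ i, ¬ i < m → A i = ∅ := fun i hi => dif_neg hi
  have hsumA : ∑ i ∈ range m, ((A i).card : ℝ) = ∑ S ∈ F, (S.card : ℝ) := by
    rw [sum_range, ← sum_coe_sort F]
    rw [← en.sum_comp]
    refine sum_congr rfl fun S _ => ?_
    rw [hAF _ (en S).2]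
    simp
  have hpow : ∀ k ≤ n, (2 : ℝ) ^ (n - k) = 2 ^ n * (1 / 2) ^ k := by
    intro k hk
    rw [← Nat.sub_add_cancel hk, pow_add, mul_assoc, ← mul_pow]
    simp
  have hKn : K ≤ n := by omega
  have h4 : (2 : ℝ) ^ K = 4 ^ j := by rw [hK, pow_mul]; norm_num
  have hKpow : (2 : ℝ) ^ (n - K) * 4 ^ j = 2 ^ n := by
    rw [← h4, ← pow_add]; congr 1; omega
  refine exists_embedding_of_edgeless_sets_of_sparse (K := K) (h := h) (a := a) (m := m)
    (C := j.centralBinom) G hG hq (by omega) hKh hhn A R ?_ ?_ ?_ ?_ ?_ ?_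
  · intro i
    by_cases hi : i < m
    · rw [hAF i hi]; exact hF1 _ (en.symm _).2
    · rw [hA0 i hi]; intro u hu; simp at hu
  · intro i i' hii
    by_cases hi : i < m
    · by_cases hi' : i' < m
      · rw [hAF i hi, hAF i' hi']
        refine hF2 _ (en.symm _).2 _ (en.symm _).2 fun e => hii ?_
        have := en.symm.injective (Subtype.ext e)
        simpa using this
      · rw [hA0 i' hi']; exact disjoint_empty_right _
    · rw [hA0 i hi]; exact disjoint_empty_left _
  · intro i
    by_cases hi : i < m
    · rw [hAF i hi]; exact hF3 _ (en.symm _).2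
    · rw [hA0 i hi]; exact disjoint_empty_left _
  · exact fun r => Nat.choose_le_centralBinom r j
  · intro v
    refine (hR v).trans ?_
    have e : n - K = 1 + (n - (K + 1) - a) + a := by omega
    rw [e, pow_add, pow_add, pow_one, mul_assoc]
    gcongr
    omega
  · have e1 : (2 * m * (j.centralBinom * 2 ^ (n - K)) : ℝ) ≤ δ * 2 ^ n := by
      have hmM : (m : ℝ) ≤ M := by exact_mod_cast hFM
      calc (2 * m * (j.centralBinom * 2 ^ (n - K)) : ℝ)
          ≤ (2 * M + 1) * ((δ / (2 * M + 1) * 4 ^ j) * 2 ^ (n - K)) := by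
            gcongr
            linarith
        _ = δ * (2 ^ (n - K) * 4 ^ j) := by field_simp
        _ = _ := by rw [hKpow]
    have e2 : (m * 2 ^ (n - K) : ℝ) ≤ δ * 2 ^ n := by
      have hmM : (m : ℝ) ≤ M := by exact_mod_cast hFM
      calc (m * 2 ^ (n - K) : ℝ) ≤ (δ * 4 ^ j) * 2 ^ (n - K) := by
            gcongr; exact hmM.trans hj2
        _ = δ * (2 ^ (n - K) * 4 ^ j) := by ring
        _ = _ := by rw [hKpow]
    have e3 : (∑ k ∈ Ioc K h, (k * (8 * q ^ 2 * k ^ 2) * 2 ^ (n - k) : ℝ)) ≤ δ * 2 ^ n := by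
      have : ∀ k ∈ Ioc K h, (k * (8 * q ^ 2 * k ^ 2) * 2 ^ (n - k) : ℝ) =
          (8 * q ^ 2 * 2 ^ n) * (k ^ 3 * (1 / 2) ^ k) := by
        intro k hk
        rw [hpow k (by have := (mem_Ioc.1 hk).2; omega)]
        ring
      rw [sum_congr rfl this, ← mul_sum]
      calc _ ≤ (8 * q ^ 2 * 2 ^ n) * (δ / (8 * q ^ 2)) := by
            gcongr
            exact hK₁ K (by omega) h
        _ = _ := by field_simp
    have e4 : (n * (8 * q ^ 2 * n ^ 2 * (2 ^ (n - (h + 1) - a) * q)) : ℝ) ≤ δ * 2 ^ n := by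
      calc (n * (8 * q ^ 2 * n ^ 2 * (2 ^ (n - (h + 1) - a) * q)) : ℝ)
          ≤ n * (8 * q ^ 2 * n ^ 2 * (2 ^ (n - (h + 1)) * q)) := by
            gcongr ?_ * (?_ * (?_ * _))
            exact pow_le_pow_right₀ (by norm_num) (Nat.sub_le _ _)
        _ = (8 * q ^ 3 * n ^ 3) * 2 ^ (n - (h + 1)) := by ring
        _ ≤ (δ * 2 ^ (h + 1)) * 2 ^ (n - (h + 1)) := by
            exact mul_le_mul_of_nonneg_right (hn₁ n hn1) (by positivity)
        _ = δ * 2 ^ n := by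
            rw [mul_assoc, ← pow_add]; congr 2; omega
    have hcap : ∀ i, (2 ^ a * (A i).card : ℝ) ≤
        q * (((A i).card / (2 ^ (n - K - a) * q) : ℕ) * 2 ^ (n - K) + 2 ^ (n - K)) := by
      intro i
      have hpos : 0 < 2 ^ (n - K - a) * q := by positivity
      have h1 := (Nat.lt_mul_div_succ (A i).card hpos).le
      have h2 : ((A i).card : ℝ) ≤ (2 ^ (n - K - a) * q) *
          (((A i).card / (2 ^ (n - K - a) * q) : ℕ) + 1) := by exact_mod_cast h1
      have h3 : (2 : ℝ) ^ (n - K) = 2 ^ a * 2 ^ (n - K - a) := by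
        rw [← pow_add]; congr 1; omega
      calc (2 ^ a * (A i).card : ℝ) ≤ 2 ^ a * ((2 ^ (n - K - a) * q) *
          (((A i).card / (2 ^ (n - K - a) * q) : ℕ) + 1)) := by gcongr
        _ = _ := by rw [h3]; ring
    set cs := ∑ i ∈ range m, (A i).card / (2 ^ (n - K - a) * q) * 2 ^ (n - K) with hcs
    have hcapsum : (2 ^ a * ∑ S ∈ F, (S.card : ℝ)) ≤ q * (cs + m * 2 ^ (n - K)) := by
      rw [← hsumA, mul_sum]
      calc _ ≤ ∑ i ∈ range m, (q * (((A i).card / (2 ^ (n - K - a) * q) : ℕ) * 2 ^ (n - K)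
              + 2 ^ (n - K)) : ℝ) := sum_le_sum fun i _ => hcap i
        _ = _ := by
            rw [← mul_sum, sum_add_distrib, sum_const, card_range, nsmul_eq_mul, hcs]
            push_cast
            rfl
    have ha' : (1 : ℝ) ≤ ε / 4 * 2 ^ a := by
      have h1 : ((1 / 2 : ℝ) ^ a) * 2 ^ a = 1 := by rw [← mul_pow]; norm_num
      calc (1 : ℝ) = (1 / 2 : ℝ) ^ a * 2 ^ a := h1.symm
        _ ≤ _ := by gcongr
    have h2a : (0 : ℝ) < 2 ^ a := by positivity
    have goal : (q * ((2 ^ n - cs : ℕ) + 2 * m * (j.centralBinom * 2 ^ (n - K)) +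
        (∑ k ∈ Ioc K h, (k * (8 * q ^ 2 * k ^ 2) * 2 ^ (n - k) : ℝ) +
          n * (8 * q ^ 2 * n ^ 2 * (2 ^ (n - (h + 1) - a) * q)))) : ℝ) ≤ 2 ^ a * R.card := by
      have hE : (q * ((2 ^ n - cs : ℕ) + 2 * m * (j.centralBinom * 2 ^ (n - K)) +
        (∑ k ∈ Ioc K h, (k * (8 * q ^ 2 * k ^ 2) * 2 ^ (n - k) : ℝ) +
          n * (8 * q ^ 2 * n ^ 2 * (2 ^ (n - (h + 1) - a) * q)))) : ℝ) ≤
          q * ((2 ^ n - cs : ℕ) + 3 * (δ * 2 ^ n)) := by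
        refine mul_le_mul_of_nonneg_left ?_ hqpos.le
        linarith
      refine hE.trans ?_
      -- If the chunks have capacity for the whole cube, `R` must still absorb the error `3 * δ * 2
      -- ^ n`, and its lower bound `ε / 4 * 2 ^ n` is used. Otherwise the total count decides, with
      -- error `4 * δ` including rounding.
      rcases le_total (2 ^ n) cs with hle | hle
      · rw [Nat.sub_eq_zero_of_le hle]
        push_cast
        have hq2 : (q : ℝ) ≤ 2 * 2 ^ a := by
          rw [hqR]
          have : (1 : ℝ) ≤ 2 ^ a := one_le_pow₀ (by norm_num)
          linarith
        calc (q * (0 + 3 * (δ * 2 ^ n)) : ℝ) ≤ (2 * 2 ^ a) * (0 + 3 * (δ * 2 ^ n)) := by gcongr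
          _ = 2 ^ a * (6 * δ * 2 ^ n) := by ring
          _ ≤ 2 ^ a * (ε / 4 * 2 ^ n) := by
              gcongr
              rw [hδ]; linarith
          _ ≤ _ := by gcongr
      · rw [Nat.cast_sub hle]
        push_cast
        have h5 : (q : ℝ) * cs ≥ 2 ^ a * ∑ S ∈ F, (S.card : ℝ) - q * (δ * 2 ^ n) := by
          have := mul_le_mul_of_nonneg_left e2 hqpos.le
          linarith
        have h6 : (q : ℝ) ≤ (1 + ε / 4) * 2 ^ a := by rw [hqR]; linarith
        have h7 : (q : ℝ) * ((1 + 4 * δ) * 2 ^ n) ≤ 2 ^ a * ((1 + ε) * 2 ^ n) := by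
          calc (q : ℝ) * ((1 + 4 * δ) * 2 ^ n)
              ≤ ((1 + ε / 4) * 2 ^ a) * ((1 + 4 * δ) * 2 ^ n) := by gcongr
            _ = 2 ^ a * (((1 + ε / 4) * (1 + 4 * δ)) * 2 ^ n) := by ring
            _ ≤ _ := by
                gcongr
                rw [hδ]
                nlinarith
        have h8 := mul_le_mul_of_nonneg_left htot h2a.le
        linarith
    exact_mod_cast goal

/-! ### Non-edges between edgeless sets -/

open Classical in
/-- The number of pairs in `S × T` that are not edges of `G`. -/
noncomputable def nonEdgeCount {V : Type*} (G : SimpleGraph V) (S T : Finset V) : ℕ :=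
  ∑ u ∈ S, (T.filter fun v => ¬ G.Adj u v).card

theorem nonEdgeCount_comm {V : Type*} (G : SimpleGraph V) (S T : Finset V) :
    nonEdgeCount G S T = nonEdgeCount G T S := by
  classical
  have h := Finset.sum_card_bipartiteAbove_eq_sum_card_bipartiteBelow (s := S) (t := T)
    fun u v => ¬ G.Adj u v
  unfold Finset.bipartiteAbove Finset.bipartiteBelow at h
  unfold nonEdgeCount
  simp only [G.adj_comm] at h ⊢
  convert h using 4

open Finset in
/-- Positive density of non-edges yields large complete bipartite patterns of non-edges. -/
theorem exists_biclique_of_nonEdgeCount {V : Type*} (G : SimpleGraph V) {l : ℕ} (hl : 0 < l)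
    (S T : Finset V) (hS : 16 * (32 * l) ≤ S.card) (hT : 32 * (2 ^ (32 * l) * l) ≤ T.card)
    (h : S.card * T.card ≤ 8 * nonEdgeCount G S T) :
    ∃ X ⊆ S, ∃ Y ⊆ T, X.card = l ∧ Y.card = l ∧ ∀ u ∈ X, ∀ v ∈ Y, ¬ G.Adj u v := by
  classical
  have hTpos : 0 < T.card := lt_of_lt_of_le (by positivity) hT
  let r : V → ℕ := fun u => (T.filter fun v => ¬ G.Adj u v).card
  have hsum : nonEdgeCount G S T = ∑ u ∈ S, r u := by
    unfold nonEdgeCount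
    exact sum_congr rfl fun u _ => by congr
  have hrT : ∀ u, r u ≤ T.card := fun u => card_filter_le _ _
  -- Non-edge density at least `1 / 8` forces a sixteenth of `S` to have at least `T.card / 16`
  -- non-neighbours in `T`. A sample `A` of `32 * l` such vertices then has on average `2 * l`
  -- non-neighbours per vertex of `T`, so `1 / 32` of `T` has at least `l` each.
  let S' := S.filter fun u => T.card ≤ 16 * r u
  have hS' : S.card ≤ 16 * S'.card := by
    have h1 : ∑ u ∈ S, 16 * r u ≤ S'.card * (16 * T.card) + S.card * T.card := by
      rw [← sum_filter_add_sum_filter_not S (fun u => T.card ≤ 16 * r u)]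
      refine Nat.add_le_add ?_ ?_
      · rw [← smul_eq_mul S'.card]
        exact sum_le_card_nsmul _ _ _ fun u _ => Nat.mul_le_mul_left _ (hrT u)
      · calc _ ≤ ∑ u ∈ S.filter fun u => ¬ T.card ≤ 16 * r u, T.card :=
              sum_le_sum fun u hu => (not_le.1 (mem_filter.1 hu).2).le
          _ ≤ ∑ u ∈ S, T.card := sum_le_sum_of_subset (filter_subset _ _)
          _ = _ := by simp
    rw [← mul_sum, ← hsum] at h1
    refine Nat.le_of_mul_le_mul_right (c := T.card) ?_ hTpos
    nlinarith
  obtain ⟨A, hAS', hA⟩ := exists_subset_card_eq (show 32 * l ≤ S'.card by omega)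
  let d : V → Finset V := fun v => A.filter fun u => ¬ G.Adj u v
  have hd : 2 * l * T.card ≤ ∑ v ∈ T, (d v).card := by
    have h1 : ∑ u ∈ A, r u = ∑ v ∈ T, (d v).card := by
      have := sum_card_bipartiteAbove_eq_sum_card_bipartiteBelow (s := A) (t := T)
        fun u v => ¬ G.Adj u v
      unfold bipartiteAbove bipartiteBelow at this
      convert this using 4
    have h2 : A.card * T.card ≤ 16 * ∑ u ∈ A, r u := by
      rw [mul_sum, ← smul_eq_mul]
      exact card_nsmul_le_sum _ _ _ fun u hu => (mem_filter.1 (hAS' hu)).2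
    rw [hA, h1] at h2
    nlinarith
  let T' := T.filter fun v => l ≤ (d v).card
  have hT' : T.card ≤ 32 * T'.card := by
    have h1 : ∑ v ∈ T, (d v).card ≤ T'.card * (32 * l) + T.card * l := by
      rw [← sum_filter_add_sum_filter_not T (fun v => l ≤ (d v).card)]
      refine Nat.add_le_add ?_ ?_
      · rw [← smul_eq_mul T'.card]
        exact sum_le_card_nsmul _ _ _ fun v _ => hA ▸ card_filter_le _ _
      · calc _ ≤ ∑ v ∈ T.filter fun v => ¬ l ≤ (d v).card, l :=
              sum_le_sum fun u hu => (not_le.1 (mem_filter.1 hu).2).le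
          _ ≤ ∑ v ∈ T, l := sum_le_sum_of_subset (filter_subset _ _)
          _ = _ := by simp
    refine Nat.le_of_mul_le_mul_right (c := l) ?_ hl
    nlinarith
  have hmaps : ∀ v ∈ T', d v ∈ A.powerset := fun v _ => mem_powerset.2 (filter_subset _ _)
  -- Pigeonhole over the `2 ^ (32 * l)` subsets of `A`: some `l` vertices of `T` share the same set
  -- of non-neighbours in `A`.
  obtain ⟨B, hB, hBc⟩ := exists_le_card_fiber_of_mul_le_card_of_maps_to (n := l) hmaps
    ⟨∅, empty_mem_powerset _⟩ (by rw [card_powerset, hA]; omega)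
  obtain ⟨Y, hYsub, hY⟩ := exists_subset_card_eq hBc
  have hYne : Y.Nonempty := by rw [← card_pos, hY]; exact hl
  have hBl : l ≤ B.card := by
    obtain ⟨y, hy⟩ := hYne
    obtain ⟨h1, h2⟩ := mem_filter.1 (hYsub hy)
    rw [← h2]
    exact (mem_filter.1 h1).2
  obtain ⟨X, hXsub, hX⟩ := exists_subset_card_eq hBl
  refine ⟨X, fun u hu => ?_, Y, fun v hv => ?_, hX, hY, fun u hu v hv => ?_⟩
  · exact (mem_filter.1 (hAS' (mem_powerset.1 hB (hXsub hu)))).1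
  · exact (mem_filter.1 (mem_filter.1 (hYsub hv)).1).1
  · have h1 := hXsub hu
    rw [← (mem_filter.1 (hYsub hv)).2] at h1
    exact (mem_filter.1 h1).2

open Finset in
theorem nonEdgeCount_le_sdiff {V : Type*} [DecidableEq V] (G : SimpleGraph V) (S T U : Finset V) :
    nonEdgeCount G S T ≤
      nonEdgeCount G (S \ U) (T \ U) + U.card * T.card + U.card * S.card := by
  classical
  have h1 : ∀ S T : Finset V, nonEdgeCount G S T ≤ nonEdgeCount G (S \ U) T + U.card * T.card := by
    intro S T
    unfold nonEdgeCount
    rw [← sum_filter_add_sum_filter_not S (fun u => u ∉ U), ← sdiff_eq_filter]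
    refine Nat.add_le_add_left ?_ _
    calc _ ≤ ∑ u ∈ S.filter fun u => ¬ u ∉ U, T.card := sum_le_sum fun u _ => card_filter_le _ _
      _ ≤ ∑ u ∈ U, T.card := sum_le_sum_of_subset fun u hu => not_not.1 (mem_filter.1 hu).2
      _ = _ := by simp
  have h2 := h1 S T
  have h3 := h1 T (S \ U)
  rw [nonEdgeCount_comm G T, nonEdgeCount_comm G (T \ U)] at h3
  have h4 : U.card * (S \ U).card ≤ U.card * S.card :=
    Nat.mul_le_mul_left _ (card_le_card sdiff_subset)
  omega

open Finset in
/-- In a triangle-free graph, three sets cannot be pairwise almost completely joined. -/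
theorem not_three_dense {V : Type*} (G : SimpleGraph V)
    (hG : ∀ a b c, G.Adj a b → G.Adj a c → ¬ G.Adj b c) (S T W : Finset V)
    (h1 : 4 * nonEdgeCount G S T < S.card * T.card)
    (h2 : 4 * nonEdgeCount G S W < S.card * W.card)
    (h3 : 4 * nonEdgeCount G T W < T.card * W.card) : False := by
  classical
  let ind : V → V → ℕ := fun u v => if G.Adj u v then 0 else 1
  have hind : ∀ S T, nonEdgeCount G S T = ∑ u ∈ S, ∑ v ∈ T, ind u v := by
    intro S T
    unfold nonEdgeCount
    refine sum_congr rfl fun u _ => ?_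
    rw [card_filter]
    refine sum_congr rfl fun v _ => ?_
    by_cases h : G.Adj u v <;> simp [ind, h]
  -- Every triple contains a non-edge, yet each of the three pairs of sets accounts for fewer than a
  -- quarter of the triples.
  have hle : S.card * T.card * W.card ≤ nonEdgeCount G S T * W.card +
      nonEdgeCount G S W * T.card + nonEdgeCount G T W * S.card := by
    calc S.card * T.card * W.card = ∑ u ∈ S, ∑ v ∈ T, ∑ w ∈ W, 1 := by
          simp [mul_assoc]
      _ ≤ ∑ u ∈ S, ∑ v ∈ T, ∑ w ∈ W, (ind u v + ind u w + ind v w) := by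
          refine sum_le_sum fun u _ => sum_le_sum fun v _ => sum_le_sum fun w _ => ?_
          by_contra hlt
          have h4 : ind u v = 0 ∧ ind u w = 0 ∧ ind v w = 0 := by omega
          have h5 : ∀ x y, ind x y = 0 → G.Adj x y := by
            intro x y h
            by_contra hn
            simp [ind, hn] at h
          exact hG u v w (h5 _ _ h4.1) (h5 _ _ h4.2.1) (h5 _ _ h4.2.2)
      _ = _ := by
          simp only [sum_add_distrib, sum_const, smul_eq_mul, hind, ← mul_sum]
          ring
  have hSTW : 0 < S.card ∧ 0 < T.card ∧ 0 < W.card := by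
    refine ⟨Nat.pos_of_ne_zero ?_, Nat.pos_of_ne_zero ?_, Nat.pos_of_ne_zero ?_⟩ <;>
    · intro h
      simp [h] at h1 h2 h3
  obtain ⟨hs, ht, hw⟩ := hSTW
  have e1 := Nat.mul_lt_mul_of_pos_right h1 hw
  have e2 := Nat.mul_lt_mul_of_pos_right h2 ht
  have e3 := Nat.mul_lt_mul_of_pos_right h3 hs
  nlinarith

open Finset in
/-- Greedy choice of disjoint complete bipartite patterns of non-edges along a walk of sets. -/
theorem exists_disjoint_links {V ι β : Type*} [DecidableEq V] [DecidableEq β] [DecidableEq ι]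
    (G : SimpleGraph V)
    (A : ι → Finset V) (g : ℕ → ι) (p : ℕ) (Z : Finset β) {l : ℕ} (hl : 0 < l)
    (hlink : ∀ t < p, (A (g t)).card * (A (g (t + 1))).card ≤
      4 * nonEdgeCount G (A (g t)) (A (g (t + 1))))
    (hsize : ∀ t ≤ p, 64 * (2 ^ (32 * l) * l) ≤ (A (g t)).card)
    (hroom : ∀ t ≤ p, 16 * (p * Z.card * (2 * l)) ≤ (A (g t)).card) :
    ∃ X Y : ℕ → β → Finset V, (∀ t < p, ∀ z ∈ Z, X t z ⊆ A (g t) ∧ Y t z ⊆ A (g (t + 1)) ∧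
      (X t z).card = l ∧ (Y t z).card = l ∧ ∀ u ∈ X t z, ∀ v ∈ Y t z, ¬ G.Adj u v) ∧
      ∀ t < p, ∀ t' < p, ∀ z ∈ Z, ∀ z' ∈ Z, (t, z) ≠ (t', z') →
        Disjoint (X t z ∪ Y t z) (X t' z' ∪ Y t' z') := by
  classical
  obtain ⟨f, hf1, hf2⟩ := exists_greedy_choice (V := Finset V × Finset V) (range p ×ˢ Z)
    (fun _ => 0)
    (fun x => {y | y.1 ⊆ A (g x.1) ∧ y.2 ⊆ A (g (x.1 + 1)) ∧ y.1.card = l ∧ y.2.card = l ∧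
      ∀ u ∈ y.1, ∀ v ∈ y.2, ¬ G.Adj u v})
    (fun _ _ y y' => ¬ Disjoint (y.1 ∪ y.2) (y'.1 ∪ y'.2))
    (fun _ _ _ _ h => fun h' => h h'.symm)
    (by
      rintro ⟨t, z⟩ hx s hs hxs - f hf
      have htp : t < p := mem_range.1 (mem_product.1 hx).1
      let U := s.biUnion fun y => (f y).1 ∪ (f y).2
      have hU : U.card ≤ p * Z.card * (2 * l) := by
        have hc : s.card ≤ p * Z.card := by
          have := card_le_card hs
          rwa [card_product, card_range] at this
        refine (card_biUnion_le_card_mul _ _ (2 * l) fun y hy => ?_).trans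
          (Nat.mul_le_mul_right _ hc)
        refine (card_union_le _ _).trans ?_
        obtain ⟨-, -, h1, h2, -⟩ := hf y hy
        omega
      set S := A (g t)
      set T := A (g (t + 1))
      have hUS : 16 * U.card ≤ S.card := (Nat.mul_le_mul_left _ hU).trans (hroom t htp.le)
      have hUT : 16 * U.card ≤ T.card := (Nat.mul_le_mul_left _ hU).trans (hroom (t + 1) htp)
      have hS := hsize t htp.le
      have hT := hsize (t + 1) htp
      have hS' := le_card_sdiff U S
      have hT' := le_card_sdiff U T
      have hl2 : 16 * l ≤ 2 ^ (32 * l) * l := by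
        refine Nat.mul_le_mul_right _ ?_
        calc 16 = 2 ^ 4 := by norm_num
          _ ≤ 2 ^ (32 * l) := Nat.pow_le_pow_right (by norm_num) (by omega)
      -- The used set `U` is at most a sixteenth of the size of each side, so it destroys at most an
      -- eighth of the pairs and the density `1 / 4` drops to no less than `1 / 8`.
      have hcount : (S \ U).card * (T \ U).card ≤ 8 * nonEdgeCount G (S \ U) (T \ U) := by
        have h1 := nonEdgeCount_le_sdiff G S T U
        have h2 := hlink t htp
        change S.card * T.card ≤ 4 * nonEdgeCount G S T at h2
        have h3 : (S \ U).card * (T \ U).card ≤ S.card * T.card :=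
          Nat.mul_le_mul (card_le_card sdiff_subset) (card_le_card sdiff_subset)
        have h4 := Nat.mul_le_mul_right T.card hUS
        have h5 := Nat.mul_le_mul_right S.card hUT
        nlinarith
      obtain ⟨X, hX, Y, hY, hXc, hYc, hXY⟩ := exists_biclique_of_nonEdgeCount G hl (S \ U) (T \ U)
        (by change 64 * _ ≤ S.card at hS; omega) (by change 64 * _ ≤ T.card at hT; omega) hcount
      refine ⟨(X, Y), ⟨hX.trans sdiff_subset, hY.trans sdiff_subset, hXc, hYc, hXY⟩, ?_⟩
      intro y hy hnd
      apply hnd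
      have hsub : (f y).1 ∪ (f y).2 ⊆ U :=
        subset_biUnion_of_mem (fun y => (f y).1 ∪ (f y).2) hy
      exact (disjoint_union_left.2 ⟨disjoint_sdiff.symm.mono_left hX,
        disjoint_sdiff.symm.mono_left hY⟩).mono_right hsub)
  refine ⟨fun t z => (f (t, z)).1, fun t z => (f (t, z)).2, ?_, ?_⟩
  · exact fun t ht z hz => hf1 (t, z) (mem_product.2 ⟨mem_range.2 ht, hz⟩)
  · intro t ht t' ht' z hz z' hz' hne
    exact not_not.1 (hf2 (t, z) (mem_product.2 ⟨mem_range.2 ht, hz⟩) (t', z')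
      (mem_product.2 ⟨mem_range.2 ht', hz'⟩) hne)

/-! ### Embedding fibre by fibre -/

open Finset in
/-- An injective choice exists if points are divided into classes with disjoint supplies that are
at least as large as the classes. -/
theorem exists_injective_choice {X V γ : Type*} [Fintype X] [DecidableEq X] [DecidableEq V]
    [DecidableEq γ] [Nonempty V] (cl : X → γ) (cand : γ → Finset V)
    (hdisj : ∀ x y, cl x ≠ cl y → Disjoint (cand (cl x)) (cand (cl y)))
    (hcard : ∀ x, (univ.filter fun y => cl y = cl x).card ≤ (cand (cl x)).card) :
    ∃ f : X → V, Function.Injective f ∧ ∀ x, f x ∈ cand (cl x) := by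
  obtain ⟨f, hf1, hf2⟩ := exists_greedy_choice (V := V) (univ : Finset X) (fun _ => 0)
    (fun x => ↑(cand (cl x))) (fun _ _ v w => v = w) (fun _ _ _ _ h => h.symm)
    (by
      intro x _ t _ hxt _ f hf
      have h1 : ((t.filter fun y => cl y = cl x).image f).card < (cand (cl x)).card := by
        have h2 : (t.filter fun y => cl y = cl x) ⊂ univ.filter fun y => cl y = cl x := by
          refine ⟨filter_subset_filter _ (subset_univ _), fun h => ?_⟩
          have : x ∈ t.filter fun y => cl y = cl x := h (by simp)
          exact hxt (mem_filter.1 this).1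
        exact card_image_le.trans_lt ((card_lt_card h2).trans_le (hcard x))
      obtain ⟨v, hv, hvn⟩ := exists_mem_notMem_of_card_lt_card h1
      refine ⟨v, hv, fun y hy hvy => ?_⟩
      by_cases hc : cl y = cl x
      · exact hvn (mem_image.2 ⟨y, mem_filter.2 ⟨hy, hc⟩, hvy.symm⟩)
      · exact disjoint_left.1 (hdisj y x hc) (hf y hy) (hvy ▸ hv))
  refine ⟨f, fun x y hxy => ?_, fun x => hf1 x (mem_univ _)⟩
  by_contra hne
  exact hf2 x (mem_univ _) y (mem_univ _) hne hxy

/-- Set the first `k` coordinates to `false`. -/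
def cubeSuffix {n : ℕ} (k : ℕ) (x : Fin n → Bool) : Fin n → Bool :=
  fun i => if i.1 < k then false else x i

theorem cubeSuffix_flipBit {n k : ℕ} {i : Fin n} (hi : i.1 < k) (x : Fin n → Bool) :
    cubeSuffix k (flipBit i x) = cubeSuffix k x := by
  funext j
  by_cases hj : j.1 < k
  · simp [cubeSuffix, hj]
  · have : j ≠ i := fun e => hj (e ▸ hi)
    simp [cubeSuffix, flipBit, hj, this]

open Finset in
theorem card_image_cubeSuffix_le {n k : ℕ} (hk : k ≤ n) :
    ((univ : Finset (Fin n → Bool)).image (cubeSuffix k)).card ≤ 2 ^ (n - k) := by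
  rw [← card_cubePrefix_class hk (fun _ : Fin n => false)]
  refine card_le_card fun z hz => ?_
  obtain ⟨x, -, rfl⟩ := mem_image.1 hz
  refine mem_filter.2 ⟨mem_univ _, cubePrefix_eq_iff.2 fun i hi => ?_⟩
  simp [cubeSuffix, hi]

open Finset in
theorem card_fibre_weight_le {n : ℕ} (k w : ℕ) (z : Fin n → Bool) :
    (univ.filter fun x => cubeWeight k x = w ∧ cubeSuffix k x = z).card ≤ k.choose w := by
  have hck : (univ.filter fun i : Fin n => i.1 < k).card ≤ k := by
    rw [Fin.card_filter_val_lt]; exact min_le_right _ _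
  have : ((univ.filter fun i : Fin n => i.1 < k).powersetCard w).card ≤ k.choose w := by
    rw [card_powersetCard]
    exact Nat.choose_le_choose w hck
  refine le_trans ?_ this
  refine card_le_card_of_injOn (fun x => univ.filter fun i : Fin n => i.1 < k ∧ x i = true) ?_ ?_
  · intro x hx
    refine mem_coe.2 (mem_powersetCard.2 ⟨fun i hi => ?_, (mem_filter.1 (mem_coe.1 hx)).2.1⟩)
    simp only [mem_filter] at hi ⊢
    exact ⟨hi.1, hi.2.1⟩
  · intro x hx y hy h
    have hx' := (mem_filter.1 (mem_coe.1 hx)).2.2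
    have hy' := (mem_filter.1 (mem_coe.1 hy)).2.2
    funext i
    by_cases hi : i.1 < k
    · have := Finset.ext_iff.1 h i
      simp only [mem_filter, mem_univ, true_and, hi] at this
      exact Bool.eq_iff_iff.2 this
    · have := congrFun (hx'.trans hy'.symm) i
      simpa [cubeSuffix, hi] using this

open Finset in
/-- Embedding of the cube fibre by fibre: weights (of the first `k` coordinates) are assigned to
edgeless sets, and at each change of set the two adjacent layers are joined without edges. -/
theorem exists_embedding_of_fibres {V ι : Type*} [DecidableEq V] [Nonempty V] [DecidableEq ι]
    {n k : ℕ} (G : SimpleGraph V) (A : ι → Finset V)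
    (hA : ∀ i, IsEdgeless G (A i)) (hAA : ∀ i j, i ≠ j → Disjoint (A i) (A j))
    (cl : ℕ → ι) (link : ℕ → Prop) [DecidablePred link] (T : ℕ → (Fin n → Bool) → Finset V)
    (U : Finset V)
    (hT : ∀ w ≤ k, link w → ∀ z ∈ univ.image (cubeSuffix k),
      T w z ⊆ A (cl w) ∧ T w z ⊆ U ∧ k.choose w ≤ (T w z).card)
    (hTT : ∀ w ≤ k, ∀ w' ≤ k, link w → link w' → ∀ z ∈ univ.image (cubeSuffix k),
      ∀ z' ∈ univ.image (cubeSuffix k), (w, z) ≠ (w', z') → Disjoint (T w z) (T w' z'))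
    (hstep : ∀ w, w + 1 ≤ k → cl w = cl (w + 1) ∨ (link w ∧ link (w + 1) ∧
      ∀ z ∈ univ.image (cubeSuffix k), ∀ u ∈ T w z, ∀ v ∈ T (w + 1) z, ¬ G.Adj u v))
    (hroom : ∀ i, (univ.filter fun x : Fin n → Bool => cl (cubeWeight k x) = i).card ≤
      (A i \ U).card) :
    ∃ f : (Fin n → Bool) → V, Function.Injective f ∧
      ∀ x y, (hypercubeGraph n).Adj x y → ¬ G.Adj (f x) (f y) := by
  classical
  -- Vertices in linked layers draw from the reserved pattern of their own fibre. All others share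
  -- their edgeless set outside the reserve `U`.
  let c : (Fin n → Bool) → ι ⊕ (ℕ × (Fin n → Bool)) := fun x =>
    if link (cubeWeight k x) then Sum.inr (cubeWeight k x, cubeSuffix k x)
    else Sum.inl (cl (cubeWeight k x))
  let cand : ι ⊕ (ℕ × (Fin n → Bool)) → Finset V :=
    Sum.elim (fun i => A i \ U) (fun y => T y.1 y.2)
  have hc1 : ∀ x, link (cubeWeight k x) →
      c x = Sum.inr (cubeWeight k x, cubeSuffix k x) := fun x hx => if_pos hx
  have hc2 : ∀ x, ¬ link (cubeWeight k x) → c x = Sum.inl (cl (cubeWeight k x)) :=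
    fun x hx => if_neg hx
  have hz : ∀ x : Fin n → Bool, cubeSuffix k x ∈ univ.image (cubeSuffix k) :=
    fun x => mem_image_of_mem _ (mem_univ x)
  obtain ⟨f, hf, hfc⟩ := exists_injective_choice c cand
    (by
      intro x y hxy
      by_cases hx : link (cubeWeight k x) <;> by_cases hy : link (cubeWeight k y)
      · rw [hc1 x hx, hc1 y hy] at hxy ⊢
        exact hTT _ (cubeWeight_le x) _ (cubeWeight_le y) hx hy _ (hz x) _ (hz y)
          fun e => hxy (by rw [e])
      · rw [hc1 x hx, hc2 y hy]
        exact (disjoint_sdiff.mono_left (hT _ (cubeWeight_le x) hx _ (hz x)).2.1)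
      · rw [hc2 x hx, hc1 y hy]
        exact (disjoint_sdiff.mono_left (hT _ (cubeWeight_le y) hy _ (hz y)).2.1).symm
      · rw [hc2 x hx, hc2 y hy] at hxy ⊢
        exact (hAA _ _ fun e => hxy (by rw [e])).mono sdiff_subset sdiff_subset)
    (by
      intro x
      by_cases hx : link (cubeWeight k x)
      · rw [hc1 x hx]
        refine le_trans ?_ (hT _ (cubeWeight_le x) hx _ (hz x)).2.2
        refine le_trans (card_le_card ?_) (card_fibre_weight_le k _ (cubeSuffix k x))
        intro y hy
        have hcy := (mem_filter.1 hy).2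
        by_cases hly : link (cubeWeight k y)
        · rw [hc1 y hly] at hcy
          have := Sum.inr_injective hcy
          exact mem_filter.2 ⟨mem_univ _, congrArg Prod.fst this, congrArg Prod.snd this⟩
        · rw [hc2 y hly] at hcy
          simp at hcy
      · rw [hc2 x hx]
        refine le_trans (card_le_card ?_) (hroom _)
        intro y hy
        have hcy := (mem_filter.1 hy).2
        by_cases hly : link (cubeWeight k y)
        · rw [hc1 y hly] at hcy
          simp at hcy
        · rw [hc2 y hly] at hcy
          exact mem_filter.2 ⟨mem_univ _, Sum.inl_injective hcy⟩)
  have hfA : ∀ x, f x ∈ A (cl (cubeWeight k x)) := by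
    intro x
    have := hfc x
    by_cases hx : link (cubeWeight k x)
    · rw [hc1 x hx] at this
      exact (hT _ (cubeWeight_le x) hx _ (hz x)).1 this
    · rw [hc2 x hx] at this
      exact sdiff_subset this
  have hsame : ∀ x y, cl (cubeWeight k x) = cl (cubeWeight k y) → ¬ G.Adj (f x) (f y) :=
    fun x y h => hA _ _ (h ▸ hfA x) _ (hfA y)
  have hup : ∀ x y, (hypercubeGraph n).Adj x y → cubeWeight k y = cubeWeight k x + 1 →
      ¬ G.Adj (f x) (f y) := by
    intro x y hxy hw
    rcases hstep (cubeWeight k x) (hw ▸ cubeWeight_le y) with h | ⟨h1, h2, h3⟩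
    · exact hsame x y (by rw [hw]; exact h)
    -- A flip that changes the weight is among the first `k` coordinates and keeps the suffix. Edges
    -- between linked layers therefore stay in one fibre, and one pattern per fibre is enough.
    · obtain ⟨i, rfl⟩ := hypercubeGraph_adj_iff.1 hxy
      have hi : i.1 < k := by
        by_contra hi
        have := cubeWeight_congr (cubePrefix_flipBit_of_le (not_lt.1 hi) x)
        omega
      have hfx := hfc x
      have hfy := hfc (flipBit i x)
      rw [hc1 x h1] at hfx
      rw [hc1 _ (hw ▸ h2), hw, cubeSuffix_flipBit hi] at hfy
      exact h3 _ (hz x) _ hfx _ hfy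
  refine ⟨f, hf, fun x y hxy => ?_⟩
  have h1 := cubeWeight_le_of_adj (K := k) hxy
  have h2 := cubeWeight_le_of_adj (K := k) hxy.symm
  rcases lt_trichotomy (cubeWeight k x) (cubeWeight k y) with h | h | h
  · exact hup x y hxy (by omega)
  · exact hsame x y (by rw [h])
  · exact fun hadj => hup y x hxy.symm (by omega) hadj.symm

/-! ### Walking through the large edgeless sets -/

open SimpleGraph in
/-- In a connected component there is a walk of bounded length through any given vertices. -/
theorem exists_walk_through {ι : Type*} [Fintype ι] [DecidableEq ι] (L : SimpleGraph ι) (b : ι)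
    (s : Finset ι) (hs : ∀ x ∈ s, L.Reachable b x) :
    ∃ c, ∃ w : L.Walk b c, (∀ x ∈ s, x ∈ w.support) ∧ w.length ≤ s.card * Fintype.card ι := by
  induction s using Finset.induction_on with
  | empty => exact ⟨b, Walk.nil, by simp, by simp⟩
  | insert a s ha ih =>
    obtain ⟨c, w, hw1, hw2⟩ := ih fun x hx => hs x (Finset.mem_insert_of_mem hx)
    have hca : L.Reachable c a := w.reachable.symm.trans (hs a (Finset.mem_insert_self _ _))
    obtain ⟨P⟩ := hca
    refine ⟨a, w.append P.toPath.1, ?_, ?_⟩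
    · intro x hx
      rw [Walk.mem_support_append_iff]
      rcases Finset.mem_insert.1 hx with rfl | hx
      · exact Or.inr (Walk.end_mem_support _)
      · exact Or.inl (hw1 x hx)
    · rw [Walk.length_append, Finset.card_insert_of_notMem ha, add_mul, one_mul]
      exact Nat.add_le_add hw2 P.toPath.2.length_lt.le

open Finset in
/-- If among any three indices two are adjacent, some component carries half of the weight. -/
theorem exists_heavy_component {ι : Type*} [Fintype ι] [Nonempty ι] (L : SimpleGraph ι)
    (h3 : ∀ a b c, a ≠ b → a ≠ c → b ≠ c → L.Adj a b ∨ L.Adj a c ∨ L.Adj b c) (wt : ι → ℝ)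
    (hwt : ∀ i, 0 ≤ wt i) :
    ∃ (b : ι) (J : Finset ι), (∀ x ∈ J, L.Reachable b x) ∧ ∑ i, wt i ≤ 2 * ∑ i ∈ J, wt i := by
  classical
  obtain ⟨a⟩ := ‹Nonempty ι›
  let J := univ.filter fun x => L.Reachable a x
  have hsplit : ∑ i ∈ J, wt i + ∑ i ∈ Jᶜ, wt i = ∑ i, wt i := sum_add_sum_compl J wt
  by_cases hJ : ∑ i, wt i ≤ 2 * ∑ i ∈ J, wt i
  · exact ⟨a, J, fun x hx => (mem_filter.1 hx).2, hJ⟩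
  rcases Jᶜ.eq_empty_or_nonempty with h0 | ⟨b, hb⟩
  · rw [h0, sum_empty, add_zero] at hsplit
    exact ⟨a, J, fun x hx => (mem_filter.1 hx).2, by
      have := sum_nonneg fun i (_ : i ∈ J) => hwt i
      linarith⟩
  · have hna : ∀ x ∈ Jᶜ, ¬ L.Reachable a x := fun x hx h =>
      mem_compl.1 hx (mem_filter.2 ⟨mem_univ _, h⟩)
    -- Two indices unreachable from `a` must be adjacent, by the condition on triples, so the
    -- complement lies in one component.
    refine ⟨b, Jᶜ, fun x hx => ?_, by linarith⟩
    by_cases hbx : b = x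
    · rw [hbx]
    · have hab : a ≠ b := fun e => hna b hb (e ▸ SimpleGraph.Reachable.refl a)
      have hax : a ≠ x := fun e => hna x hx (e ▸ SimpleGraph.Reachable.refl a)
      rcases h3 a b x hab hax hbx with h | h | h
      · exact absurd h.reachable (hna b hb)
      · exact absurd h.reachable (hna x hx)
      · exact h.reachable

open Finset in
/-- Embedding of the cube into edgeless sets visited by a walk, consecutive ones not being almost
completely joined. -/
theorem exists_embedding_along_walk {V ι : Type*} [DecidableEq V] [Nonempty V] [DecidableEq ι]
    {n k l p : ℕ} (G : SimpleGraph V) (A : ι → Finset V)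
    (hA : ∀ i, IsEdgeless G (A i)) (hAA : ∀ i j, i ≠ j → Disjoint (A i) (A j))
    (g : ℕ → ι) (hk : k ≤ n) (hl0 : 0 < l) (hl : ∀ w, k.choose w ≤ l)
    (hne : ∀ t < p, g t ≠ g (t + 1))
    (hlink : ∀ t < p, (A (g t)).card * (A (g (t + 1))).card ≤
      4 * nonEdgeCount G (A (g t)) (A (g (t + 1))))
    (hbig : ∀ t ≤ p, 64 * (2 ^ (32 * l) * l) ≤ (A (g t)).card)
    (hroom : ∀ t ≤ p, 16 * ((2 * p + 2) * (2 * (l * 2 ^ (n - k)))) ≤ (A (g t)).card)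
    (J : Finset ι) (hJ : ∀ i ∈ J, ∃ t ≤ p, g t = i)
    (htot : 2 ^ n + (2 * p + 2) * (l * 2 ^ (n - k)) +
      J.card * ((2 * p + 2) * (2 * (l * 2 ^ (n - k)))) < ∑ i ∈ J, (A i).card) :
    ∃ f : (Fin n → Bool) → V, Function.Injective f ∧
      ∀ x y, (hypercubeGraph n).Adj x y → ¬ G.Adj (f x) (f y) := by
  classical
  obtain ⟨l', hl'⟩ : ∃ l', l' = l * 2 ^ (n - k) := ⟨_, rfl⟩
  rw [← hl'] at htot hroom
  let Z := (univ : Finset (Fin n → Bool)).image (cubeSuffix k)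
  have hZ : Z.card ≤ 2 ^ (n - k) := card_image_cubeSuffix_le hk
  obtain ⟨X, Y, hXY, hXYd⟩ := exists_disjoint_links G A g p Z hl0 hlink hbig
    (by
      intro t ht
      refine le_trans (Nat.mul_le_mul_left _ ?_) (hroom t ht)
      calc p * Z.card * (2 * l) ≤ (2 * p + 2) * 2 ^ (n - k) * (2 * l) := by
            gcongr
            omega
        _ = (2 * p + 2) * (2 * l') := by rw [hl']; ring)
  have hτ : ∀ i, ∃ t, i ∈ J → t ≤ p ∧ g t = i := by
    intro i
    by_cases hi : i ∈ J
    · obtain ⟨t, h1, h2⟩ := hJ i hi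
      exact ⟨t, fun _ => ⟨h1, h2⟩⟩
    · exact ⟨0, fun h => absurd h hi⟩
  choose τ hτ using hτ
  -- Two weight intervals `2 * t` and `2 * t + 1` for each position `t` of the walk, so that the
  -- layer by which a set is entered differs from the layer by which it is left. Each set of `J` is
  -- filled only at its chosen visit `τ`; all other intervals have capacity `0` and only pass
  -- through.
  let c : ℕ → ℕ := fun s => if s % 2 = 0 ∧ g (s / 2) ∈ J ∧ τ (g (s / 2)) = s / 2 then
    (A (g (s / 2))).card - (2 * p + 2) * (2 * l') else 0
  have hlw : ∀ j, (univ.filter fun x : Fin n → Bool => cubeWeight k x = j).card ≤ l' := fun j =>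
    (card_cubeWeight_eq_le hk j).trans (hl' ▸ Nat.mul_le_mul_right _ (hl j))
  obtain ⟨e, he0, he, hec⟩ := exists_cut_points (M := k + 1) _ hlw c
  set D : ℕ → Finset (Fin n → Bool) := fun i =>
    univ.filter fun x => e i ≤ cubeWeight k x ∧ cubeWeight k x + 1 < e (i + 1) with hD
  have hcτ : ∀ i ∈ J, c (2 * τ i) = (A i).card - (2 * p + 2) * (2 * l') := by
    intro i hi
    have h1 : 2 * τ i / 2 = τ i := by omega
    have h2 := (hτ i hi).2
    have h3 : 2 * τ i % 2 = 0 := by omega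
    simp only [c, h1, h2, h3, hi, true_and, if_true]
  -- The total capacity exceeds `2 ^ n` plus one layer per interval, so the intervals along the walk
  -- exhaust all weights.
  have hkS : k < e (2 * p + 2) := by
    by_contra hlt
    have hdis : ∀ i ∈ range (2 * p + 2), ∀ j ∈ range (2 * p + 2), i ≠ j →
        Disjoint (D i) (D j) := by
      intro i _ j _ hij
      rw [disjoint_left]
      intro x hx hy
      obtain ⟨-, h1, h2⟩ := mem_filter.1 hx
      obtain ⟨-, h3, h4⟩ := mem_filter.1 hy
      exact hij (le_antisymm
        (cut_interval_unique he h1 (by omega : cubeWeight k x < e (j + 1)) le_rfl)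
        (cut_interval_unique he h3 (by omega : cubeWeight k x < e (i + 1)) le_rfl))
    have h1 : ∑ s ∈ range (2 * p + 2), c s ≤ 2 ^ n + (2 * p + 2) * l' := by
      calc ∑ s ∈ range (2 * p + 2), c s ≤ ∑ s ∈ range (2 * p + 2), ((D s).card + l') := by
            refine sum_le_sum fun s hs => (hec s).2.resolve_left ?_
            have := he.monotone (Nat.succ_le_of_lt (mem_range.1 hs))
            simp only [Nat.succ_eq_add_one] at this
            omega
        _ = ((range (2 * p + 2)).biUnion D).card + (2 * p + 2) * l' := by
            rw [sum_add_distrib, card_biUnion hdis, sum_const, card_range, smul_eq_mul]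
        _ ≤ _ := by
            refine Nat.add_le_add_right ((card_le_univ _).trans ?_) _
            simp
    have h2 : ∑ i ∈ J, c (2 * τ i) ≤ ∑ s ∈ range (2 * p + 2), c s := by
      rw [← sum_image (f := c) (g := fun i => 2 * τ i)]
      · refine sum_le_sum_of_subset fun s hs => ?_
        obtain ⟨i, hi, rfl⟩ := mem_image.1 hs
        have := (hτ i hi).1
        exact mem_range.2 (by omega)
      · intro i hi j hj hij
        have h3 : τ i = τ j := by simpa using hij
        rw [← (hτ i hi).2, ← (hτ j hj).2, h3]
    have h3 : ∑ i ∈ J, (A i).card ≤ ∑ i ∈ J, c (2 * τ i) +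
        J.card * ((2 * p + 2) * (2 * l')) := by
      rw [← smul_eq_mul J.card, ← sum_const, ← sum_add_distrib]
      refine sum_le_sum fun i hi => ?_
      rw [hcτ i hi]
      omega
    omega
  choose side hside1 hside2 using exists_mem_cut_interval he0 he
  have hside_eq : ∀ w s, e s ≤ w → w < e (s + 1) → side w = s := fun w s h1 h2 =>
    le_antisymm (cut_interval_unique he (hside1 w) h2 le_rfl)
      (cut_interval_unique he h1 (hside2 w) le_rfl)
  have hsideS : ∀ w ≤ k, side w < 2 * p + 2 := fun w hw =>
    he.lt_iff_lt.1 ((hside1 w).trans_lt (hw.trans_lt hkS))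
  -- The last layer of an odd interval and the first layer of the next even one: between them the
  -- embedding moves to the next set of the walk.
  let link : ℕ → Prop := fun w => (side w % 2 = 1 ∧ w + 1 = e (side w + 1) ∧ side w / 2 < p) ∨
    (side w % 2 = 0 ∧ 2 ≤ side w ∧ w = e (side w))
  let idx : ℕ → ℕ := fun w => if side w % 2 = 1 then side w / 2 else side w / 2 - 1
  let T : ℕ → (Fin n → Bool) → Finset V := fun w z =>
    if side w % 2 = 1 then X (side w / 2) z else Y (side w / 2 - 1) z
  let U : Finset V := (range p ×ˢ Z).biUnion fun y => X y.1 y.2 ∪ Y y.1 y.2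
  have hidx : ∀ w ≤ k, link w → idx w < p := by
    rintro w hw (⟨h1, h2, h3⟩ | ⟨h1, h2, h3⟩)
    · simp only [idx, h1, if_true]; exact h3
    · have := hsideS w hw
      simp only [idx, h1]
      simp only [Nat.zero_ne_one, if_false]
      omega
  have hTsub : ∀ w z, T w z ⊆ X (idx w) z ∪ Y (idx w) z := by
    intro w z
    by_cases h1 : side w % 2 = 1
    · simp only [T, idx, h1, if_true]; exact subset_union_left
    · simp only [T, idx, h1, if_false]; exact subset_union_right
  have hUc : U.card ≤ 2 * p * l' := by
    refine (card_biUnion_le_card_mul _ _ (2 * l) fun y hy => ?_).trans ?_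
    · obtain ⟨h1, h2⟩ := mem_product.1 hy
      obtain ⟨-, -, h3, h4, -⟩ := hXY y.1 (mem_range.1 h1) y.2 h2
      exact (card_union_le _ _).trans (by omega)
    · rw [card_product, card_range]
      calc p * Z.card * (2 * l) ≤ p * 2 ^ (n - k) * (2 * l) := by gcongr
        _ = _ := by rw [hl']; ring
  refine exists_embedding_of_fibres (k := k) G A hA hAA (fun w => g (side w / 2)) link T U
    ?_ ?_ ?_ ?_
  · intro w hw hlw z hz
    have hi := hidx w hw hlw
    refine ⟨?_, (hTsub w z).trans (subset_biUnion_of_mem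
      (fun y : ℕ × (Fin n → Bool) => X y.1 y.2 ∪ Y y.1 y.2)
      (mem_product.2 ⟨mem_range.2 hi, hz⟩ : (idx w, z) ∈ range p ×ˢ Z)), ?_⟩
    · rcases hlw with ⟨h1, h2, h3⟩ | ⟨h1, h2, h3⟩
      · simp only [T, h1, if_true]
        exact (hXY _ h3 z hz).1
      · simp only [idx, h1, Nat.zero_ne_one, if_false] at hi
        have := (hXY _ hi z hz).2.1
        simp only [T, h1, Nat.zero_ne_one, if_false]
        rwa [Nat.sub_add_cancel (by omega)] at this
    · refine (hl w).trans ?_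
      obtain ⟨-, -, h3, h4, -⟩ := hXY _ hi z hz
      by_cases h1 : side w % 2 = 1
      · simp only [idx, h1, if_true] at h3
        simp only [T, h1, if_true]
        exact h3.ge
      · simp only [idx, h1, if_false] at h4
        simp only [T, h1, if_false]
        exact h4.ge
  · intro w hw w' hw' hlw hlw' z hz z' hz' hne'
    have hi := hidx w hw hlw
    have hi' := hidx w' hw' hlw'
    by_cases heq : (idx w, z) = (idx w', z')
    · have hz1 : z = z' := congrArg Prod.snd heq
      have hi1 : idx w = idx w' := congrArg Prod.fst heq
      subst hz1
      have hww : w ≠ w' := fun h => hne' (by rw [h])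
      have hXYdis : ∀ t < p, Disjoint (X t z) (Y t z) := fun t ht =>
        (hAA _ _ (hne t ht)).mono (hXY t ht z hz).1 (hXY t ht z hz).2.1
      rcases hlw with ⟨h1, h2, h3⟩ | ⟨h1, h2, h3⟩ <;>
        rcases hlw' with ⟨h1', h2', h3'⟩ | ⟨h1', h2', h3'⟩
      · simp only [idx, h1, h1', if_true] at hi1
        have : side w = side w' := by omega
        rw [this] at h2
        omega
      · simp only [idx, h1, h1', Nat.zero_ne_one, if_true, if_false] at hi1
        simp only [T, h1, h1', Nat.zero_ne_one, if_true, if_false, hi1]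
        exact hXYdis _ (hi1 ▸ h3)
      · simp only [idx, h1, h1', Nat.zero_ne_one, if_true, if_false] at hi1
        simp only [T, h1, h1', Nat.zero_ne_one, if_true, if_false, hi1]
        exact (hXYdis _ h3').symm
      · simp only [idx, h1, h1', Nat.zero_ne_one, if_false] at hi1
        have : side w = side w' := by omega
        rw [this] at h3
        omega
    · exact (hXYd _ hi _ hi' z hz z' hz' heq).mono (hTsub w z) (hTsub w' z')
  · intro w hw
    by_cases hlt : w + 1 < e (side w + 1)
    · left
      rw [hside_eq (w + 1) (side w) ((hside1 w).trans (Nat.le_succ w)) hlt]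
    · have hw1 : w + 1 = e (side w + 1) := by
        have := hside2 w
        omega
      have hs1 : side (w + 1) = side w + 1 :=
        hside_eq _ _ hw1.ge (by rw [hw1]; exact he (Nat.lt_succ_self _))
      by_cases hodd : side w % 2 = 1
      · right
        have hS := hsideS (w + 1) hw
        have hp : side w / 2 < p := by omega
        refine ⟨Or.inl ⟨hodd, hw1, hp⟩, Or.inr ⟨by omega, by omega, by rw [hs1]; exact hw1⟩, ?_⟩
        intro z hz
        have h1 : ¬ side (w + 1) % 2 = 1 := by omega
        have h2 : side (w + 1) / 2 - 1 = side w / 2 := by omega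
        simp only [T, hodd, h1, if_true, if_false, h2]
        exact (hXY _ hp z hz).2.2.2.2
      · left
        rw [hs1]
        congr 1
        omega
  · intro i
    rcases (univ.filter fun x : Fin n → Bool => g (side (cubeWeight k x) / 2) = i).eq_empty_or_nonempty
      with h0 | ⟨x₀, hx₀⟩
    · rw [h0]; simp
    have hx₀' := (mem_filter.1 hx₀).2
    have hAi : 16 * ((2 * p + 2) * (2 * l')) ≤ (A i).card := by
      rw [← hx₀']
      refine hroom _ ?_
      have := hsideS _ (cubeWeight_le x₀)
      omega
    -- A set may be visited many times. Outside its chosen interval it receives only the last layers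
    -- of intervals, for which `c` left room together with the reserve `U`.
    let E := (range (2 * p + 2)).biUnion fun s =>
      univ.filter fun x : Fin n → Bool => cubeWeight k x = e (s + 1) - 1
    have hE : E.card ≤ (2 * p + 2) * l' := by
      have := card_biUnion_le_card_mul (range (2 * p + 2)) (fun s =>
        univ.filter fun x : Fin n → Bool => cubeWeight k x = e (s + 1) - 1) l' fun s _ => hlw _
      rwa [card_range] at this
    let D' : Finset (Fin n → Bool) := if i ∈ J then D (2 * τ i) else ∅
    have hD' : D'.card ≤ (A i).card - (2 * p + 2) * (2 * l') := by
      by_cases hi : i ∈ J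
      · simp only [D', hi, if_true]
        rw [← hcτ i hi]
        exact (hec _).1
      · simp [D', hi]
    have hsub : (univ.filter fun x : Fin n → Bool => g (side (cubeWeight k x) / 2) = i) ⊆
        D' ∪ E := by
      intro x hx
      have hxi := (mem_filter.1 hx).2
      have hs1 := hside1 (cubeWeight k x)
      have hs2 := hside2 (cubeWeight k x)
      have hs3 := hsideS _ (cubeWeight_le (K := k) x)
      by_cases hlast : cubeWeight k x + 1 < e (side (cubeWeight k x) + 1)
      · refine mem_union_left _ ?_
        have hxD : x ∈ D (side (cubeWeight k x)) := mem_filter.2 ⟨mem_univ _, hs1, hlast⟩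
        have hpos : 0 < c (side (cubeWeight k x)) := (card_pos.2 ⟨x, hxD⟩).trans_le (hec _).1
        by_cases hcond : side (cubeWeight k x) % 2 = 0 ∧ g (side (cubeWeight k x) / 2) ∈ J ∧
            τ (g (side (cubeWeight k x) / 2)) = side (cubeWeight k x) / 2
        · obtain ⟨h1, h2, h3⟩ := hcond
          rw [hxi] at h2 h3
          simp only [D', h2, if_true]
          have : 2 * τ i = side (cubeWeight k x) := by omega
          rw [this]
          exact hxD
        · simp [c, hcond] at hpos
      · refine mem_union_right _ (mem_biUnion.2 ⟨_, mem_range.2 hs3, mem_filter.2 ⟨mem_univ _, ?_⟩⟩)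
        omega
    have h1 := (card_le_card hsub).trans (card_union_le _ _)
    have h2 := le_card_sdiff U (A i)
    have h3 : (2 * p + 2) * l' + 2 * p * l' ≤ (2 * p + 2) * (2 * l') := by nlinarith
    omega

open Finset in
/-- Embedding of the cube into boundedly many large edgeless sets of total size more
than `2 * 2 ^ n`. -/
theorem exists_embedding_of_card_edgeless_ge {ε : ℝ} (hε : 0 < ε) (K₀ M : ℕ) :
    ∃ n₀, ∀ n ≥ n₀, ∀ (V : Type) [DecidableEq V] (G : SimpleGraph V),
      (∀ a b c, G.Adj a b → G.Adj a c → ¬ G.Adj b c) →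
      ∀ F : Finset (Finset V), (∀ S ∈ F, IsEdgeless G S) →
      (∀ S ∈ F, ∀ T ∈ F, S ≠ T → Disjoint S T) → F.card ≤ M →
      (∀ S ∈ F, 2 ^ (n - K₀) ≤ S.card) → (2 + ε) * 2 ^ n ≤ ∑ S ∈ F, (S.card : ℝ) →
      ∃ f : (Fin n → Bool) → V, Function.Injective f ∧
        ∀ x y, (hypercubeGraph n).Adj x y → ¬ G.Adj (f x) (f y) := by
  -- Bounds the number `2 * p + 2` of intervals, as a walk through at most `M` of at most `M`
  -- indices needs length at most `M * M`.
  obtain ⟨s, hs⟩ : ∃ s, s = 2 * (M * M) + 2 := ⟨_, rfl⟩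
  have hs0 : 0 < s := by omega
  have hsR : (0 : ℝ) < s := by exact_mod_cast hs0
  -- The first bound lets layers and patterns fit into sets of size `2 ^ (n - K₀)`; the second keeps
  -- the total loss below `ε / 4 * 2 ^ n`.
  set θ : ℝ := min (1 / (32 * s * 2 ^ K₀)) (ε / (4 * ((2 * M + 1) * s))) with hθ
  have hθ0 : 0 < θ := lt_min (by positivity) (by positivity)
  obtain ⟨j, hj⟩ := (eventually_centralBinom_le hθ0).exists
  obtain ⟨l, hl⟩ : ∃ l, l = j.centralBinom := ⟨_, rfl⟩
  have hl0 : 0 < l := hl ▸ j.centralBinom_pos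
  refine ⟨K₀ + 2 * j + 64 * (2 ^ (32 * l) * l), ?_⟩
  intro n hn V _ G hG F hF1 hF2 hFM hF3 htot
  classical
  have hkn : 2 * j ≤ n := by omega
  have hl' : ((l * 2 ^ (n - 2 * j) : ℕ) : ℝ) ≤ θ * 2 ^ n := by
    have h1 : (2 : ℝ) ^ n = 4 ^ j * 2 ^ (n - 2 * j) := by
      have : (4 : ℝ) ^ j = 2 ^ (2 * j) := by rw [pow_mul]; norm_num
      rw [this, ← pow_add]; congr 1; omega
    push_cast
    rw [h1, hl, ← mul_assoc]
    gcongr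
  obtain ⟨l', hl'eq⟩ : ∃ l', l' = l * 2 ^ (n - 2 * j) := ⟨_, rfl⟩
  rw [← hl'eq] at hl'
  have hN : (0 : ℝ) < 2 ^ n := by positivity
  have hbig : 64 * (2 ^ (32 * l) * l) ≤ 2 ^ (n - K₀) :=
    Nat.lt_two_pow_self.le.trans (Nat.pow_le_pow_right (by norm_num) (by omega))
  have hroom : 16 * (s * (2 * l')) ≤ 2 ^ (n - K₀) := by
    have h1 : (16 * (s * (2 * l')) : ℝ) ≤ 2 ^ (n - K₀) := by
      have h2 : (2 : ℝ) ^ n = 2 ^ (n - K₀) * 2 ^ K₀ := by rw [← pow_add]; congr 1; omega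
      calc (16 * (s * (2 * l')) : ℝ) ≤ 16 * (s * (2 * (θ * 2 ^ n))) := by gcongr
        _ = (32 * s * θ) * 2 ^ n := by ring
        _ ≤ (32 * s * (1 / (32 * s * 2 ^ K₀))) * 2 ^ n := by
            gcongr; exact min_le_left _ _
        _ = 2 ^ (n - K₀) := by rw [h2]; field_simp
    exact_mod_cast h1
  have hFne : F.Nonempty := by
    by_contra h
    rw [not_nonempty_iff_eq_empty.1 h, sum_empty] at htot
    have : 0 < (2 + ε) * 2 ^ n := by positivity
    linarith
  obtain ⟨S₀, hS₀⟩ := hFne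
  have hS₀ne : S₀.Nonempty := card_pos.1 (lt_of_lt_of_le (by positivity) (hF3 S₀ hS₀))
  have : Nonempty V := ⟨hS₀ne.choose⟩
  have : Nonempty F := ⟨⟨S₀, hS₀⟩⟩
  let A : F → Finset V := fun i => i.1
  let L : SimpleGraph F :=
    { Adj := fun a b => a ≠ b ∧ (A a).card * (A b).card ≤ 4 * nonEdgeCount G (A a) (A b)
      symm := ⟨fun a b h => ⟨h.1.symm, by
        rw [mul_comm, nonEdgeCount_comm]; exact h.2⟩⟩
      loopless := ⟨fun a h => h.1 rfl⟩ }
  have h3 : ∀ a b c : F, a ≠ b → a ≠ c → b ≠ c → L.Adj a b ∨ L.Adj a c ∨ L.Adj b c := by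
    intro a b c hab hac hbc
    by_contra hcon
    push Not at hcon
    obtain ⟨h1, h2, h3⟩ := hcon
    exact not_three_dense G hG (A a) (A b) (A c) (not_le.1 fun h => h1 ⟨hab, h⟩)
      (not_le.1 fun h => h2 ⟨hac, h⟩) (not_le.1 fun h => h3 ⟨hbc, h⟩)
  obtain ⟨b, J, hJ, hJw⟩ := exists_heavy_component L h3 (fun i => ((A i).card : ℝ))
    fun i => by positivity
  obtain ⟨c, w, hw1, hw2⟩ := exists_walk_through L b J hJ
  have hcardF : Fintype.card F = F.card := Fintype.card_coe F
  have hJM : J.card ≤ M := (card_le_univ J).trans (hcardF ▸ hFM)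
  have hp : w.length ≤ M * M := hw2.trans (Nat.mul_le_mul hJM (hcardF ▸ hFM))
  have hps : 2 * w.length + 2 ≤ s := by omega
  refine exists_embedding_along_walk (k := 2 * j) (l := l) (p := w.length) G A
    (fun i => hF1 _ i.2) (fun i j hij => hF2 _ i.2 _ j.2 fun e => hij (Subtype.ext e))
    (fun t => w.getVert t) hkn hl0 (fun r => hl ▸ Nat.choose_le_centralBinom r j) ?_ ?_ ?_ ?_ J ?_ ?_
  · exact fun t ht => (w.adj_getVert_succ ht).1
  · exact fun t ht => (w.adj_getVert_succ ht).2
  · exact fun t _ => hbig.trans (hF3 _ (w.getVert t).2)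
  · intro t _
    rw [← hl'eq]
    refine le_trans ?_ (hroom.trans (hF3 _ (w.getVert t).2))
    gcongr
  · intro i hi
    obtain ⟨t, ht1, ht2⟩ := SimpleGraph.Walk.mem_support_iff_exists_getVert.1 (hw1 i hi)
    exact ⟨t, ht2, ht1⟩
  · rw [← hl'eq]
    have hsumF : ∑ i : F, ((A i).card : ℝ) = ∑ S ∈ F, (S.card : ℝ) :=
      sum_coe_sort F fun S => (S.card : ℝ)
    have h1 : ((2 ^ n + (2 * w.length + 2) * l' + J.card * ((2 * w.length + 2) * (2 * l')) : ℕ) : ℝ)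
        < ((∑ i ∈ J, (A i).card : ℕ) : ℝ) := by
      have hps' : (2 * w.length + 2 : ℝ) ≤ s := by exact_mod_cast hps
      have hJM' : (J.card : ℝ) ≤ M := by exact_mod_cast hJM
      push_cast
      calc (2 ^ n + (2 * w.length + 2) * l' + J.card * ((2 * w.length + 2) * (2 * l')) : ℝ)
          ≤ 2 ^ n + s * (θ * 2 ^ n) + M * (s * (2 * (θ * 2 ^ n))) := by gcongr
        _ = 2 ^ n + ((2 * M + 1) * s * θ) * 2 ^ n := by ring
        _ ≤ 2 ^ n + ((2 * M + 1) * s * (ε / (4 * ((2 * M + 1) * s)))) * 2 ^ n := by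
            gcongr; exact min_le_right _ _
        _ = (1 + ε / 4) * 2 ^ n := by field_simp
        _ < (1 + ε / 2) * 2 ^ n := by
            refine mul_lt_mul_of_pos_right ?_ hN
            linarith
        _ ≤ ∑ i ∈ J, ((A i).card : ℝ) := by
            rw [hsumF] at hJw
            linarith
    exact_mod_cast h1

/-! ### Choice of scale and the upper bound -/

open Finset in
/-- A graph without triangles on slightly more than `2 ^ (n + 1)` vertices has the cube in its
complement. -/
theorem exists_embedding_of_triangleFree {ε : ℝ} (hε : 0 < ε) (hε1 : ε ≤ 1) :
    ∃ n₀, ∀ n ≥ n₀, ∀ (V : Type) [DecidableEq V] (G : SimpleGraph V),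
      (∀ a b c, G.Adj a b → G.Adj a c → ¬ G.Adj b c) →
      ∀ W : Finset V, (1 + ε) * 2 ^ (n + 1) ≤ (W.card : ℝ) →
      ∃ f : (Fin n → Bool) → V, Function.Injective f ∧
        ∀ x y, (hypercubeGraph n).Adj x y → ¬ G.Adj (f x) (f y) := by
  choose κ nA hA using fun K₀ : ℕ => exists_embedding_of_card_sparse_ge hε hε1 (2 ^ (K₀ + 3))
  choose nB hB using fun K₀ : ℕ => exists_embedding_of_card_edgeless_ge hε K₀ (2 ^ (K₀ + 3))
  -- The next scale makes the remainder sparse enough for the number of sets of size `2 ^ (n - K t)`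
  -- already present, at most `2 ^ (K t + 3)` because `W` has at most `8 * 2 ^ n` vertices.
  let K : ℕ → ℕ := fun t => Nat.rec 0 (fun _ k => max k (κ k)) t
  have hKs : ∀ t, K (t + 1) = max (K t) (κ (K t)) := fun t => rfl
  -- Each step of the iteration removes `ε / 8 * 2 ^ n` vertices out of at most `8 * 2 ^ n`.
  obtain ⟨T, hT⟩ := exists_nat_gt (64 / ε)
  have hTε : 8 < T * (ε / 8) := by
    rw [div_lt_iff₀ hε] at hT
    linarith
  refine ⟨∑ t ∈ range T, (nA (K t) + nB (K t) + K (t + 1)), ?_⟩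
  intro n hn V _ G hG W₀ hW₀
  have hnt : ∀ t < T, nA (K t) + nB (K t) + K (t + 1) ≤ n := fun t ht =>
    (single_le_sum (f := fun t => nA (K t) + nB (K t) + K (t + 1)) (fun _ _ => Nat.zero_le _)
      (mem_range.2 ht)).trans hn
  have hN : (0 : ℝ) < 2 ^ n := by positivity
  have hN1 : (1 : ℝ) ≤ 2 ^ n := one_le_pow₀ (by norm_num)
  obtain ⟨W, hWW, hWc⟩ := exists_subset_card_eq
    (show ⌈(1 + ε) * 2 ^ (n + 1)⌉₊ ≤ W₀.card from Nat.ceil_le.2 hW₀)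
  have hW1 : (2 + 2 * ε) * 2 ^ n ≤ (W.card : ℝ) := by
    rw [hWc]
    refine le_trans (le_of_eq ?_) (Nat.le_ceil _)
    ring
  have hW2 : (W.card : ℝ) ≤ 8 * 2 ^ n := by
    rw [hWc]
    have h1 := (Nat.ceil_lt_add_one (show 0 ≤ (1 + ε) * 2 ^ (n + 1) by positivity)).le
    refine h1.trans ?_
    rw [pow_succ]
    nlinarith
  by_contra hno
  have hstate : ∀ t ≤ T, ∃ (F : Finset (Finset V)) (R : Finset V), (∀ S ∈ F, IsEdgeless G S) ∧
      (∀ S ∈ F, ∀ S' ∈ F, S ≠ S' → Disjoint S S') ∧ (∀ S ∈ F, Disjoint S R) ∧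
      (∀ S ∈ F, 2 ^ (n - K t) ≤ S.card) ∧ W.card = ∑ S ∈ F, S.card + R.card ∧
      (R.card : ℝ) + t * (ε / 8 * 2 ^ n) ≤ W.card := by
    intro t
    induction t with
    | zero =>
      intro _
      exact ⟨∅, W, by simp, by simp, by simp, by simp, by simp, by simp⟩
    | succ t ih =>
      intro ht
      obtain ⟨F, R, h1, h2, h3, h4, h5, h6⟩ := ih (by omega)
      have hnt' := hnt t ht
      obtain ⟨E, e1, e2, e3⟩ := exists_edgeless_family G hG
        (show 0 < 2 ^ (n - K (t + 1)) by positivity) R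
      have hEsub : E.biUnion id ⊆ R := biUnion_subset.2 fun S hS => (e1 S hS).1
      have hEcard : (E.biUnion id).card = ∑ S ∈ E, S.card :=
        card_biUnion fun S hS T hT hne => e2 S hS T hT hne
      have hR' : (R \ E.biUnion id).card + ∑ S ∈ E, S.card = R.card := by
        rw [← hEcard]; exact card_sdiff_add_card_eq_card hEsub
      set R' := R \ E.biUnion id
      have hsumF : (W.card : ℝ) = ∑ S ∈ F, (S.card : ℝ) + R.card := by
        rw [h5]; push_cast; rfl
      -- Either the finer sets `E` take a fixed proportion and are kept, or they are so few that
      -- they can be discarded: the coarse sets `F` are then combined with `R'`, which is sparse at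
      -- the finer scale.
      by_cases hgap : (R'.card : ℝ) + ε / 8 * 2 ^ n ≤ R.card
      · refine ⟨F ∪ E, R', ?_, ?_, ?_, ?_, ?_, ?_⟩
        · intro S hS
          rcases mem_union.1 hS with hS | hS
          · exact h1 S hS
          · exact (e1 S hS).2.2
        · intro S hS S' hS' hne
          rcases mem_union.1 hS with hS | hS <;> rcases mem_union.1 hS' with hS' | hS'
          · exact h2 S hS S' hS' hne
          · exact (h3 S hS).mono_right (e1 S' hS').1
          · exact ((h3 S' hS').mono_right (e1 S hS).1).symm
          · exact e2 S hS S' hS' hne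
        · intro S hS
          rcases mem_union.1 hS with hS | hS
          · exact (h3 S hS).mono_right sdiff_subset
          · exact disjoint_sdiff.mono_left (subset_biUnion_of_mem id hS)
        · intro S hS
          rcases mem_union.1 hS with hS | hS
          · refine le_trans (Nat.pow_le_pow_right (by norm_num) ?_) (h4 S hS)
            have : K t ≤ K (t + 1) := by rw [hKs]; exact le_max_left _ _
            omega
          · exact (e1 S hS).2.1.ge
        · have hd : Disjoint F E := by
            rw [disjoint_left]
            intro S hS hSE
            have hdis := (h3 S hS).mono_right (e1 S hSE).1
            rw [disjoint_self_iff_empty] at hdis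
            have := (e1 S hSE).2.1
            rw [hdis, card_empty] at this
            have : 0 < 2 ^ (n - K (t + 1)) := by positivity
            omega
          rw [sum_union hd]
          omega
        · push_cast
          linarith
      · exfalso
        apply hno
        have hFM : F.card ≤ 2 ^ (K t + 3) := by
          have hKn : K t ≤ n := by
            have : K t ≤ K (t + 1) := by rw [hKs]; exact le_max_left _ _
            omega
          have c1 : F.card * 2 ^ (n - K t) ≤ W.card := by
            rw [h5, ← smul_eq_mul]
            exact (card_nsmul_le_sum _ _ _ h4).trans (Nat.le_add_right _ _)
          have c2 : W.card ≤ 2 ^ (K t + 3) * 2 ^ (n - K t) := by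
            rw [← pow_add, show K t + 3 + (n - K t) = 3 + n by omega, pow_add]
            exact_mod_cast hW2
          exact Nat.le_of_mul_le_mul_right (c1.trans c2) (by positivity)
        -- If `R'` is small, `F` retains at least `(2 + 2 * ε - ε / 4 - ε / 8) * 2 ^ n` vertices.
        by_cases hRbig : ε / 4 * 2 ^ n ≤ (R'.card : ℝ)
        · refine hA (K t) n (by omega) V G hG F R' h1 h2
            (fun S hS => (h3 S hS).mono_right sdiff_subset) hFM (fun v => ?_) hRbig ?_
          · refine (e3 v).le.trans (Nat.pow_le_pow_right (by norm_num) ?_)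
            have : κ (K t) ≤ K (t + 1) := by rw [hKs]; exact le_max_right _ _
            omega
          · nlinarith
        · refine hB (K t) n (by omega) V G hG F h1 h2 hFM h4 ?_
          nlinarith
  obtain ⟨F, R, -, -, -, -, -, h⟩ := hstate T le_rfl
  have h0 : (0 : ℝ) ≤ R.card := by positivity
  nlinarith

/-! ### Colourings, the lower bound and the asymptotics -/

theorem edgeColour_ne_blue {c : EdgeColour} (h : c ≠ EdgeColour.blue) : c = EdgeColour.red := by
  cases c
  · rfl
  · exact absurd rfl h

theorem blue_triangleFree {N : ℕ} {c : RedBlueColouring N} (h : ¬ triangleGraph ⊑ blueGraph c)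
    (x y z : Fin N) (hxy : (blueGraph c).Adj x y) (hxz : (blueGraph c).Adj x z) :
    ¬ (blueGraph c).Adj y z := by
  intro hyz
  have h3 : (blueGraph c).IsNClique 3 {x, y, z} := by
    rw [SimpleGraph.is3Clique_triple_iff]
    exact ⟨hxy, hxz, hyz⟩
  have hf : ¬ (blueGraph c).CliqueFree 3 := fun hf => hf _ h3
  exact h ((SimpleGraph.not_cliqueFree_iff_top_isContained 3).1 hf)

theorem hypercubeGraph_isContained_red {n N : ℕ} {c : RedBlueColouring N}
    (f : (Fin n → Bool) → Fin N) (hf : Function.Injective f)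
    (h : ∀ x y, (hypercubeGraph n).Adj x y → ¬ (blueGraph c).Adj (f x) (f y)) :
    hypercubeGraph n ⊑ redGraph c := by
  refine ⟨⟨⟨f, ?_⟩, hf⟩⟩
  intro x y hxy
  have hne : f x ≠ f y := fun e => hxy.ne (hf e)
  have hb := h x y hxy
  rw [SimpleGraph.TopEdgeLabeling.labelGraph_adj] at hb ⊢
  push Not at hb
  exact ⟨hne, edgeColour_ne_blue (hb hne)⟩

theorem red_hypercube_of_no_blue_triangle (ε : ℝ) (hε : 0 < ε) : ∃ n₀ : ℕ, ∀ n : ℕ, n₀ ≤ n →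
    ∀ N : ℕ, (1 + ε) * (2 : ℝ) ^ (n + 1) ≤ (N : ℝ) → ∀ c : RedBlueColouring N,
      ¬ (triangleGraph ⊑ blueGraph c) → hypercubeGraph n ⊑ redGraph c := by
  obtain ⟨n₀, h⟩ := exists_embedding_of_triangleFree (lt_min hε one_pos) (min_le_right ε 1)
  refine ⟨n₀, fun n hn N hN c hc => ?_⟩
  obtain ⟨f, hf, hadj⟩ := h n hn (Fin N) (blueGraph c) (blue_triangleFree hc) Finset.univ (by
    rw [Finset.card_univ, Fintype.card_fin]
    refine le_trans ?_ hN
    gcongr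
    exact min_le_left _ _)
  exact hypercubeGraph_isContained_red f hf hadj

theorem hypercubeGraph_isContained_of_le {n m : ℕ} (h : n ≤ m) :
    hypercubeGraph n ⊑ hypercubeGraph m := by
  let f : (Fin n → Bool) → (Fin m → Bool) := fun x i => if hi : i.1 < n then x ⟨i.1, hi⟩ else false
  refine ⟨⟨⟨f, ?_⟩, ?_⟩⟩
  · intro x y hxy
    obtain ⟨i, rfl⟩ := hypercubeGraph_adj_iff.1 hxy
    refine hypercubeGraph_adj_iff.2 ⟨⟨i.1, i.2.trans_le h⟩, ?_⟩
    funext j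
    by_cases hj : j.1 = i.1
    · have : j = ⟨i.1, i.2.trans_le h⟩ := Fin.ext hj
      subst this
      simp [f, flipBit]
    · have h1 : j ≠ ⟨i.1, i.2.trans_le h⟩ := fun e => hj (congrArg Fin.val e)
      by_cases hjn : j.1 < n
      · have h2 : (⟨j.1, hjn⟩ : Fin n) ≠ i := fun e => hj (congrArg Fin.val e)
        simp [f, flipBit, h1, h2, hjn]
      · simp [f, flipBit, h1, hjn]
  · intro x y hxy
    funext i
    have := congrFun hxy ⟨i.1, i.2.trans_le h⟩
    simpa [f] using this

theorem mem_ramsey_set_of_no_blue_triangle {n N : ℕ}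
    (h : ∀ c : RedBlueColouring N, ¬ (triangleGraph ⊑ blueGraph c) →
      hypercubeGraph n ⊑ redGraph c) :
    N ∈ {N : ℕ | ∀ c : RedBlueColouring N,
      triangleGraph ⊑ blueGraph c ∨ hypercubeGraph n ⊑ redGraph c} :=
  fun c => or_iff_not_imp_left.2 (h c)

/-- Without this the infimum could be the default value `0`, which would ruin the lower bound. Small
`n` are covered by embedding the cube in a larger one. -/
theorem ramsey_set_nonempty (n : ℕ) : {N : ℕ | ∀ c : RedBlueColouring N,
    triangleGraph ⊑ blueGraph c ∨ hypercubeGraph n ⊑ redGraph c}.Nonempty := by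
  obtain ⟨n₀, h⟩ := red_hypercube_of_no_blue_triangle 1 one_pos
  refine ⟨2 * 2 ^ (max n n₀ + 1), mem_ramsey_set_of_no_blue_triangle fun c hc => ?_⟩
  refine (hypercubeGraph_isContained_of_le (le_max_left n n₀)).trans
    (h _ (le_max_right n n₀) _ ?_ c hc)
  push_cast
  linarith

/-- A two-valued function on the cube that respects adjacency is constant. -/
theorem eq_of_forall_adj_eq {n : ℕ} {α : Type*} (g : (Fin n → Bool) → α)
    (hg : ∀ x y, (hypercubeGraph n).Adj x y → g x = g y) (x y : Fin n → Bool) : g x = g y := by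
  classical
  have key : ∀ k ≤ n, g (fun i => if i.1 < k then y i else x i) = g x := by
    intro k
    induction k with
    | zero => intro _; simp
    | succ k ih =>
      intro hk
      rw [← ih (by omega)]
      have hstep : (fun i : Fin n => if i.1 < k + 1 then y i else x i) =
          Function.update (fun i : Fin n => if i.1 < k then y i else x i) ⟨k, hk⟩ (y ⟨k, hk⟩) := by
        funext i
        by_cases hi : i = ⟨k, hk⟩
        · subst hi; simp
        · have : i.1 ≠ k := fun e => hi (Fin.ext e)
          have h1 : i.1 < k + 1 ↔ i.1 < k := by omega
          simp [hi, h1]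
      by_cases hxy : x ⟨k, hk⟩ = y ⟨k, hk⟩
      · rw [hstep, Function.update_eq_self_iff.2 (by simp [hxy])]
      · refine (hg _ _ (hypercubeGraph_adj_iff.2 ⟨⟨k, hk⟩, ?_⟩)).symm
        rw [hstep, flipBit]
        congr 1
        revert hxy
        simp only [lt_irrefl, if_false]
        cases x ⟨k, hk⟩ <;> cases y ⟨k, hk⟩ <;> simp
  rw [← key n le_rfl]
  congr 1
  funext i
  simp

/-- For `N ≤ 2 ^ (n + 1) - 2`, split the vertices into two parts of size at most `2 ^ n - 1` and
colour the edges between them blue. The blue graph is bipartite, and a red cube, being connected,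
would lie in one part. -/
theorem le_ramseyNumber (n : ℕ) :
    2 ^ (n + 1) - 1 ≤ ramseyNumber triangleGraph (hypercubeGraph n) := by
  refine le_csInf (ramsey_set_nonempty n) fun N hN => ?_
  by_contra hlt
  classical
  let side : Fin N → Bool := fun x => decide (x.1 < 2 ^ n - 1)
  let c : RedBlueColouring N := SimpleGraph.EdgeLabeling.mk
    (fun x y _ => if side x = side y then EdgeColour.red else EdgeColour.blue)
    (fun x y _ => by simp only [eq_comm])
  have hget : ∀ x y (h : x ≠ y), c.get x y h =
      if side x = side y then EdgeColour.red else EdgeColour.blue := fun x y h => rfl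
  rcases hN c with ⟨⟨f⟩⟩ | ⟨⟨f⟩⟩
  · have hb : ∀ i j : Fin 3, i ≠ j → side (f i) ≠ side (f j) := by
      intro i j hij
      obtain ⟨h, h'⟩ := (SimpleGraph.TopEdgeLabeling.labelGraph_adj _ _).1 (f.toHom.map_adj
        (show triangleGraph.Adj i j from hij))
      intro he
      have h2 := (hget _ _ h).symm.trans h'
      rw [if_pos (show side (f.toHom i) = side (f.toHom j) from he)] at h2
      cases h2
    have h01 := hb 0 1 (by decide)
    have h02 := hb 0 2 (by decide)
    have h12 := hb 1 2 (by decide)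
    revert h01 h02 h12
    cases side (f 0) <;> cases side (f 1) <;> cases side (f 2) <;> simp
  · have hr : ∀ x y, (hypercubeGraph n).Adj x y → side (f x) = side (f y) := by
      intro x y hxy
      obtain ⟨h, h'⟩ := (SimpleGraph.TopEdgeLabeling.labelGraph_adj _ _).1 (f.toHom.map_adj hxy)
      by_contra he
      have h2 := (hget _ _ h).symm.trans h'
      rw [if_neg (show ¬ side (f.toHom x) = side (f.toHom y) from he)] at h2
      cases h2
    have hconst := eq_of_forall_adj_eq (fun x => side (f x)) hr
    have h2n : 0 < 2 ^ n := by positivity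
    have hpow : 2 ^ (n + 1) = 2 * 2 ^ n := by ring
    let x₀ : Fin n → Bool := fun _ => false
    have hcard : ∀ (g : (Fin n → Bool) → Fin (2 ^ n - 1)), Function.Injective g → False := by
      intro g hg
      have := Fintype.card_le_of_injective g hg
      simp only [Fintype.card_pi, Fintype.card_bool, Finset.prod_const, Finset.card_univ,
        Fintype.card_fin] at this
      omega
    by_cases h0 : side (f x₀) = true
    · have hall : ∀ x, (f x).1 < 2 ^ n - 1 := fun x => by
        have := (hconst x x₀).trans h0
        simpa [side] using this
      refine hcard (fun x => ⟨(f x).1, hall x⟩) fun x y hxy => f.injective (Fin.ext ?_)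
      simpa using hxy
    · have hall : ∀ x, ¬ (f x).1 < 2 ^ n - 1 := fun x h => by
        have := hconst x x₀
        simp only [side, h, decide_true] at this
        exact h0 this.symm
      refine hcard (fun x => ⟨(f x).1 - (2 ^ n - 1), ?_⟩) fun x y hxy => f.injective (Fin.ext (?_ : (f x).1 = (f y).1))
      · have := (f x).2
        have := hall x
        omega
      · have h1 : (f x).1 - (2 ^ n - 1) = (f y).1 - (2 ^ n - 1) := by simpa using hxy
        have := hall x
        have := hall y
        omega

theorem ramseyNumber_isEquivalent :
    (fun n : ℕ => (ramseyNumber triangleGraph (hypercubeGraph n) : ℝ))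
      ~[atTop] (fun n : ℕ => (2 : ℝ) ^ (n + 1)) := by
  refine isLittleO_iff.2 fun ε hε => ?_
  obtain ⟨n₀, h⟩ := red_hypercube_of_no_blue_triangle (ε / 2) (by positivity)
  -- Absorbs the `- 1` of the lower bound and the rounding up in the upper bound.
  have hpow : ∀ᶠ n : ℕ in atTop, 1 ≤ ε / 2 * (2 : ℝ) ^ (n + 1) := by
    have h1 := (tendsto_pow_atTop_atTop_of_one_lt (show (1 : ℝ) < 2 by norm_num)).const_mul_atTop
      (show 0 < ε / 2 by positivity)
    exact (h1.comp (tendsto_add_atTop_nat 1)).eventually_ge_atTop 1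
  filter_upwards [hpow, eventually_ge_atTop n₀] with n hn hn₀
  have hN : (0 : ℝ) < 2 ^ (n + 1) := by positivity
  have hlow : (2 : ℝ) ^ (n + 1) ≤ ramseyNumber triangleGraph (hypercubeGraph n) + 1 := by
    have h1 := le_ramseyNumber n
    have h2 : 2 ^ (n + 1) ≤ ramseyNumber triangleGraph (hypercubeGraph n) + 1 := by omega
    exact_mod_cast h2
  have hup : (ramseyNumber triangleGraph (hypercubeGraph n) : ℝ) ≤
      (1 + ε / 2) * 2 ^ (n + 1) + 1 := by
    have h1 : ramseyNumber triangleGraph (hypercubeGraph n) ≤ ⌈(1 + ε / 2) * (2 : ℝ) ^ (n + 1)⌉₊ :=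
      Nat.sInf_le (mem_ramsey_set_of_no_blue_triangle (h n hn₀ _ (Nat.le_ceil _)))
    have h2 := (Nat.ceil_lt_add_one (show 0 ≤ (1 + ε / 2) * (2 : ℝ) ^ (n + 1) by positivity)).le
    exact le_trans (by exact_mod_cast h1) h2
  simp only [Pi.sub_apply, Real.norm_eq_abs]
  rw [abs_of_pos hN, abs_le]
  constructor <;> nlinarith

/-- `r(K_3, Q_n) = (1 + o(1)) 2^{n+1}` as `n → ∞`, together with the lower bound
`r(K_3, Q_n) ≥ 2^{n+1} - 1` for every `n` and the upper bound in its colouring form. -/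
theorem theorem1 :
    ((fun n : ℕ => (ramseyNumber triangleGraph (hypercubeGraph n) : ℝ))
        ~[atTop] (fun n : ℕ => (2 : ℝ) ^ (n + 1)))
    ∧ (∀ n : ℕ, 2 ^ (n + 1) - 1 ≤ ramseyNumber triangleGraph (hypercubeGraph n))
    ∧ (∀ ε : ℝ, 0 < ε → ∃ n₀ : ℕ, ∀ n : ℕ, n₀ ≤ n →
        ∀ N : ℕ, (1 + ε) * (2 : ℝ) ^ (n + 1) ≤ (N : ℝ) →
          ∀ c : RedBlueColouring N,
            ¬ (triangleGraph ⊑ blueGraph c) → hypercubeGraph n ⊑ redGraph c) :=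
  ⟨ramseyNumber_isEquivalent, le_ramseyNumber, red_hypercube_of_no_blue_triangle⟩
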